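/- For a one-hidden-layer ReLU network $\theta=(k,w^{(1)},b^{(1)},w^{(2)},b^{(2)})$ with $k\in\mathbb N$, $w^{(1)},b^{(1)},w^{(2)}\in\mathbb R^k$, $b^{(2)}\in\mathbb R$, let $$h_\theta(x)=\sum_{i=1}^k w^{(2)}_i\max(0,w^{(1)}_ix+b^{(1)}_i)+b^{(2)},\qquad C(\theta)=\tfrac12\sum_{i=1}^k\big((w_i^{(2)})^2+(w_i^{(1)})^2\big),$$ let $\Theta_2$ be the set of all such $\theta$ (of every width $k$) and $\mathcal N=\{h_\theta:\theta\in\Theta_2\}$. For $f:\mathbb R\to\mathbb R$ put $$V(f)=\max\Big(\int_{-\infty}^{\infty}|f''(x)|\,dx,\ |f'(-\infty)+f'(\infty)|\Big)\in[0,\infty],$$ where $f''$ is the distributional second derivative, $\int|f''|$ is its total variation if $f$ is continuous and $f''$ is a finite signed measure and $\infty$ otherwise, and $f'(\pm\infty)$ are the limits of $f'$ along the points where $f$ is differentiable. For a weight function $w:\mathbb R\to(0,\infty)$ put $$\overline R_w(f)=\lim_{\epsilon\to0}\ \inf\{C(\theta):\ \theta\in\Theta_2,\ |h_\theta(x)-f(x)|\le\epsilon\,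 w(x)\ \text{for all }x\in\mathbb R\}\in[0,\infty].$$ Let $L$ be any function from the set of all functions $f:\mathbb R\to\mathbb R$ to $\mathbb R\cup\{\infty\}$, let $\lambda>0$, and write $J(\theta)=L(h_\theta)+\lambda C(\theta)$ and $G(f)=L(f)+\lambda V(f)$. Then minimizing $J$ is equivalent to minimizing $G$ in the following sense. 1. (Networks of arbitrary finite width, any $L$.) For every $f\in\mathcal N$, $\min\{J(\theta):h_\theta=f\}$ is attained and equals $G(f)$. The functions $h_\theta$ with $\theta$ a minimizer of $J$ over $\Theta_2$ are exactly the minimizers of $G$ over $\mathcal N$. 2. (Limits of networks of unbounded width, any $L$.) With $w(x)=1+|x|$, the problems of minimizing $L(f)+\lambda\overline R_w(f)$ and $G(f)$ over all $f:\mathbb R\to\mathbb R$ have the same infimum and the same minimizers. 3. (Uniform limits, any $L$.) Let $\overline{\mathcal N}$ be the set of uniform limits on $\mathbb R$ of functions in $\mathcal N$. The infimum of $L(f)+\lambda\overline R_1(f)$ over all $f:\mathbb R\to\mathbb R$ equals the infimum of $G$ over $\overline{\mathcal N}$, and $f\in\overline{\mathcal N}$ minimizes the former over all functions if and only if it minimizes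 $G$ over $\overline{\mathcal N}$. 4. (Networks of arbitrary finite width against all functions.) Suppose that $L$ is upper semicontinuous in the following weak sense: whenever $V(f)<\infty$ and $L(f)<c$, there are a finite set $S\subset\mathbb R$ and $\delta>0$ such that $L(g)<c$ for every $g$ that agrees with $f$ on $S$ and for which $g-f$ is $\delta$-Lipschitz. (This holds for every loss that depends only on the values of $f$ at finitely many points, and for every loss that is upper semicontinuous for locally uniform convergence.) Then $$\inf_{\theta\in\Theta_2}L(h_\theta)+\lambda C(\theta)=\inf_{f:\mathbb R\to\mathbb R}L(f)+\lambda V(f);$$ the functions $h_\theta$ with $\theta$ a minimizer of $J$ are exactly the functions in $\mathcal N$ that minimize $G$ over all $f:\mathbb R\to\mathbb R$; and for every $f$, every $c>G(f)$ and every $\epsilon>0$ there is $\theta\in\Theta_2$ with $J(\theta)<c$ and $|h_\theta(x)-f(x)|\le\epsilon(1+|x|)$ for all $x\in\mathbb R$. -/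

import Mathlib

open Filter MeasureTheory
open scoped ENNReal ContDiff

noncomputable section

/-- Parameters of a one-hidden-layer ReLU network with one real input and an arbitrary
(finite) number `k` of hidden units. -/
structure ReLUNet where
  k : ℕ
  w₁ : Fin k → ℝ
  b₁ : Fin k → ℝ
  w₂ : Fin k → ℝ
  b₂ : ℝ

namespace ReLUNet

/-- The function `h_θ` computed by the network. -/
def toFun (θ : ReLUNet) (x : ℝ) : ℝ :=
  ∑ i, θ.w₂ i * max 0 (θ.w₁ i * x + θ.b₁ i) + θ.b₂

/-- Half the squared Euclidean norm of the non-bias weights. -/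
def cost (θ : ReLUNet) : ℝ :=
  1 / 2 * ∑ i, (θ.w₂ i ^ 2 + θ.w₁ i ^ 2)

end ReLUNet

/-- `f` is continuous and its second distributional derivative is the finite signed measure `μ`.
Continuity selects the representative of `f` (a loss may evaluate `f` at points). -/
def HasSecondDeriv (f : ℝ → ℝ) (μ : SignedMeasure ℝ) : Prop :=
  Continuous f ∧ ∀ φ : ℝ → ℝ, ContDiff ℝ ∞ φ → HasCompactSupport φ →
    ∫ x, f x * iteratedDeriv 2 φ x = ∫ᵛ x, φ x ∂<•μ

/-- `∫ |f''|`: the total mass of the second distributional derivative of `f`, which is `∞` when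
that derivative is not a finite signed measure. -/
def secondVariation (f : ℝ → ℝ) : ℝ≥0∞ :=
  ⨅ (μ : SignedMeasure ℝ) (_ : HasSecondDeriv f μ), μ.totalVariation Set.univ

/-- The limit of `f' x` as `x` tends to `l` through the points where `f` is differentiable. -/
def derivLim (l : Filter ℝ) (f : ℝ → ℝ) : ℝ :=
  limUnder (l ⊓ 𝓟 {x | DifferentiableAt ℝ f x}) (deriv f)

/-- `max (∫ |f''|, |f'(-∞) + f'(∞)|)`. -/
def penalty (f : ℝ → ℝ) : ℝ≥0∞ :=
  max (secondVariation f) (ENNReal.ofReal |derivLim atBot f + derivLim atTop f|)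

/-- The limit, as `ε → 0`, of the least cost of a network `h_θ` with `|h_θ - f| ≤ ε * w`
everywhere; this least cost grows as `ε` decreases, so the limit is a supremum. -/
def limitCost (w : ℝ → ℝ) (f : ℝ → ℝ) : ℝ≥0∞ :=
  ⨆ (ε : ℝ) (_ : 0 < ε), ⨅ (θ : ReLUNet) (_ : ∀ x, |θ.toFun x - f x| ≤ ε * w x),
    ENNReal.ofReal θ.cost

/-- The functions that are uniform limits on `ℝ` of networks. -/
def uniformLimits : Set (ℝ → ℝ) :=
  {f | ∀ ε : ℝ, 0 < ε → ∃ θ : ReLUNet, ∀ x, |θ.toFun x - f x| ≤ ε}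

/-- The regularized training objective of a network. -/
def netObjective (L : (ℝ → ℝ) → EReal) (lam : ℝ) (θ : ReLUNet) : EReal :=
  L θ.toFun + (lam : EReal) * (θ.cost : EReal)

/-- The objective in function space with regularizer `R`. -/
def funObjective (L : (ℝ → ℝ) → EReal) (lam : ℝ) (R : (ℝ → ℝ) → ℝ≥0∞) (f : ℝ → ℝ) : EReal :=
  L f + (lam : EReal) * (R f : EReal)

/-- Upper semicontinuity of a loss, at the functions of finite penalty, for a very fine topology:
`g` is close to `f` when `g = f` on a large finite set and `g - f` has a small Lipschitz constant.
It holds for every loss that depends only on the values of `f` at finitely many points, and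
for every loss that is upper semicontinuous for pointwise convergence, for locally uniform
convergence, or for the norm `sup |f x| / (1 + |x|)`. -/
def LossUSC (L : (ℝ → ℝ) → EReal) : Prop :=
  ∀ f : ℝ → ℝ, penalty f < ⊤ → ∀ c : EReal, L f < c →
    ∃ (S : Finset ℝ) (δ : ℝ), 0 < δ ∧ ∀ g : ℝ → ℝ, (∀ x ∈ S, g x = f x) →
      (∀ x y, |(g x - f x) - (g y - f y)| ≤ δ * |x - y|) → L g < c

end

noncomputable section

/-! ### Test functions -/

section TestFunctions

variable {φ : ℝ → ℝ}

theorem iteratedDeriv_two_eq (φ : ℝ → ℝ) : iteratedDeriv 2 φ = deriv (deriv φ) := by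
  rw [iteratedDeriv_succ, iteratedDeriv_one]

theorem ContDiff.deriv_infty (h : ContDiff ℝ ∞ φ) : ContDiff ℝ ∞ (deriv φ) :=
  ((contDiff_infty_iff_deriv).1 h).2

theorem ContDiff.hasDerivAt_infty (h : ContDiff ℝ ∞ φ) (x : ℝ) : HasDerivAt φ (deriv φ x) x :=
  ((contDiff_infty_iff_deriv).1 h).1.differentiableAt.hasDerivAt

theorem HasCompactSupport.tendsto_mul_atTop (h : HasCompactSupport φ) (g : ℝ → ℝ) :
    Tendsto (fun x => g x * φ x) atTop (nhds 0) := by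
  have h0 : φ =ᶠ[cocompact ℝ] 0 := hasCompactSupport_iff_eventuallyEq.1 h |>.filter_mono
    (by rw [coclosedCompact_eq_cocompact])
  refine tendsto_const_nhds.congr' ?_
  filter_upwards [h0.filter_mono atTop_le_cocompact] with x hx
  simp [hx]

theorem HasCompactSupport.tendsto_mul_atBot (h : HasCompactSupport φ) (g : ℝ → ℝ) :
    Tendsto (fun x => g x * φ x) atBot (nhds 0) := by
  have h0 : φ =ᶠ[cocompact ℝ] 0 := hasCompactSupport_iff_eventuallyEq.1 h |>.filter_mono
    (by rw [coclosedCompact_eq_cocompact])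
  refine tendsto_const_nhds.congr' ?_
  filter_upwards [h0.filter_mono atBot_le_cocompact] with x hx
  simp [hx]

theorem integrable_mul_iteratedDeriv_two (h : ContDiff ℝ ∞ φ) (hc : HasCompactSupport φ)
    {u : ℝ → ℝ} (hu : Continuous u) : Integrable fun x => u x * iteratedDeriv 2 φ x := by
  rw [iteratedDeriv_two_eq]
  exact (hu.mul h.deriv_infty.deriv_infty.continuous).integrable_of_hasCompactSupport
    hc.deriv.deriv.mul_left

theorem hasDerivAt_affine_parts (h : ContDiff ℝ ∞ φ) (a b x : ℝ) :
    HasDerivAt (fun x => (a * x + b) * deriv φ x - a * φ x)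
      ((a * x + b) * iteratedDeriv 2 φ x) x := by
  rw [iteratedDeriv_two_eq]
  have h1 : HasDerivAt (fun x => a * x + b) a x := by
    simpa using ((hasDerivAt_id x).const_mul a).add_const b
  refine ((h1.mul (h.deriv_infty.hasDerivAt_infty x)).sub
    ((h.hasDerivAt_infty x).const_mul a)).congr_deriv ?_
  ring

theorem tendsto_affine_parts_atTop (hc : HasCompactSupport φ) (a b : ℝ) :
    Tendsto (fun x => (a * x + b) * deriv φ x - a * φ x) atTop (nhds 0) := by
  simpa using (hc.deriv.tendsto_mul_atTop fun x => a * x + b).sub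
    (hc.tendsto_mul_atTop fun _ => a)

theorem tendsto_affine_parts_atBot (hc : HasCompactSupport φ) (a b : ℝ) :
    Tendsto (fun x => (a * x + b) * deriv φ x - a * φ x) atBot (nhds 0) := by
  simpa using (hc.deriv.tendsto_mul_atBot fun x => a * x + b).sub
    (hc.tendsto_mul_atBot fun _ => a)

theorem integral_affine_mul_iteratedDeriv_two (h : ContDiff ℝ ∞ φ) (hc : HasCompactSupport φ)
    (a b : ℝ) : ∫ x, (a * x + b) * iteratedDeriv 2 φ x = 0 := by
  have := integral_of_hasDerivAt_of_tendsto (hasDerivAt_affine_parts h a b)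
    (integrable_mul_iteratedDeriv_two h hc (u := fun x => a * x + b) (by fun_prop))
    (tendsto_affine_parts_atBot hc a b) (tendsto_affine_parts_atTop hc a b)
  simpa using this

/-- `|x - t| / 2` is a fundamental solution of the second derivative. -/
theorem integral_abs_sub_mul_iteratedDeriv_two (h : ContDiff ℝ ∞ φ) (hc : HasCompactSupport φ)
    (t : ℝ) : ∫ x, |x - t| * iteratedDeriv 2 φ x = 2 * φ t := by
  have hi := integrable_mul_iteratedDeriv_two h hc (u := fun x => |x - t|) (by fun_prop)
  rw [← intervalIntegral.integral_Iic_add_Ioi (b := t) hi.integrableOn hi.integrableOn]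
  have e1 : ∫ x in Set.Iic t, |x - t| * iteratedDeriv 2 φ x = φ t := by
    have : ∫ x in Set.Iic t, |x - t| * iteratedDeriv 2 φ x
        = ∫ x in Set.Iic t, ((-1) * x + t) * iteratedDeriv 2 φ x := by
      refine setIntegral_congr_fun measurableSet_Iic fun x hx => ?_
      simp only [Set.mem_Iic] at hx
      rw [abs_of_nonpos (by linarith)]
      ring
    rw [this, integral_Iic_of_hasDerivAt_of_tendsto' (fun x _ => hasDerivAt_affine_parts h (-1) t x)
      (integrable_mul_iteratedDeriv_two h hc (u := fun x => (-1) * x + t) (by fun_prop)).integrableOn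
      (tendsto_affine_parts_atBot hc (-1) t)]
    ring
  have e2 : ∫ x in Set.Ioi t, |x - t| * iteratedDeriv 2 φ x = φ t := by
    have : ∫ x in Set.Ioi t, |x - t| * iteratedDeriv 2 φ x
        = ∫ x in Set.Ioi t, (1 * x + (-t)) * iteratedDeriv 2 φ x := by
      refine setIntegral_congr_fun measurableSet_Ioi fun x hx => ?_
      simp only [Set.mem_Ioi] at hx
      rw [abs_of_pos (by linarith)]
      ring
    rw [this, integral_Ioi_of_hasDerivAt_of_tendsto' (fun x _ => hasDerivAt_affine_parts h 1 (-t) x)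
      (integrable_mul_iteratedDeriv_two h hc (u := fun x => 1 * x + (-t)) (by fun_prop)).integrableOn
      (tendsto_affine_parts_atTop hc 1 (-t))]
    ring
  rw [e1, e2]
  ring

theorem iteratedDeriv_two_comp_const_sub (φ : ℝ → ℝ) (x : ℝ) :
    iteratedDeriv 2 (fun s => φ (x - s)) = fun s => deriv (deriv φ) (x - s) := by
  rw [iteratedDeriv_two_eq]
  have h1 : deriv (fun s => φ (x - s)) = fun s => -(deriv φ (x - s)) := by
    funext s
    exact deriv_comp_const_sub φ x s
  rw [h1]
  funext s
  rw [deriv.fun_neg, deriv_comp_const_sub (deriv φ) x s, neg_neg]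

/-- A continuous function whose second distributional derivative vanishes is affine. -/
theorem exists_affine_of_integral_mul_iteratedDeriv_two_eq_zero {u : ℝ → ℝ} (hu : Continuous u)
    (h : ∀ φ : ℝ → ℝ, ContDiff ℝ ∞ φ → HasCompactSupport φ →
      ∫ x, u x * iteratedDeriv 2 φ x = 0) :
    ∃ a b : ℝ, ∀ x, u x = a * x + b := by
  have key : ∀ ρ : ContDiffBump (0 : ℝ), ∀ x : ℝ,
      (MeasureTheory.convolution (ρ.normed volume) u (ContinuousLinearMap.lsmul ℝ ℝ) volume) x =
      ((MeasureTheory.convolution (ρ.normed volume) u (ContinuousLinearMap.lsmul ℝ ℝ) volume) 1 -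
       (MeasureTheory.convolution (ρ.normed volume) u (ContinuousLinearMap.lsmul ℝ ℝ) volume) 0) * x +
      (MeasureTheory.convolution (ρ.normed volume) u (ContinuousLinearMap.lsmul ℝ ℝ) volume) 0 := by
    intro ρ
    set r := ρ.normed volume with hr
    have hs : ContDiff ℝ ∞ r := ρ.contDiff_normed
    have hcs : HasCompactSupport r := ρ.hasCompactSupport_normed
    set v := MeasureTheory.convolution r u (ContinuousLinearMap.lsmul ℝ ℝ) volume with hv
    set v' := MeasureTheory.convolution (deriv r) u (ContinuousLinearMap.lsmul ℝ ℝ) volume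
    have d1 : ∀ x, HasDerivAt v (v' x) x := fun x =>
      hcs.hasDerivAt_convolution_left _ (hs.of_le (by simp)) hu.locallyIntegrable x
    have d2 : ∀ x, HasDerivAt v' 0 x := by
      intro x
      have := hcs.deriv.hasDerivAt_convolution_left (ContinuousLinearMap.lsmul ℝ ℝ)
        (hs.deriv_infty.of_le (by simp)) hu.locallyIntegrable (μ := volume) x
      refine this.congr_deriv ?_
      rw [convolution_eq_swap]
      simp only [ContinuousLinearMap.lsmul_apply, smul_eq_mul]
      have e := h (fun s => r (x - s)) (hs.comp (contDiff_const.sub contDiff_id))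
        (hcs.comp_homeomorph (Homeomorph.subLeft x))
      rw [iteratedDeriv_two_comp_const_sub r] at e
      refine Eq.trans ?_ e
      exact integral_congr_ae (ae_of_all _ fun s => mul_comm _ _)
    have c1 : ∀ x, v' x = v' 0 := fun x =>
      is_const_of_deriv_eq_zero (fun x => (d2 x).differentiableAt) (fun x => (d2 x).deriv) x 0
    have d3 : ∀ x, HasDerivAt (fun x => v x - v' 0 * x) 0 x := by
      intro x
      have := (d1 x).sub ((hasDerivAt_id x).const_mul (v' 0))
      exact this.congr_deriv (by simp [c1 x])
    have c2 : ∀ x, v x - v' 0 * x = v 0 := fun x => by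
      simpa using
        is_const_of_deriv_eq_zero (fun x => (d3 x).differentiableAt) (fun x => (d3 x).deriv) x 0
    intro x
    have := c2 x
    have := c2 1
    have e : v' 0 = v 1 - v 0 := by linarith
    rw [← e]
    linarith
  let ρ : ℕ → ContDiffBump (0 : ℝ) := fun n =>
    ⟨1 / (n + 1) / 2, 1 / (n + 1), by positivity, half_lt_self (by positivity)⟩
  have hρ : Tendsto (fun n => (ρ n).rOut) atTop (nhds 0) := tendsto_one_div_add_atTop_nhds_zero_nat
  have lim : ∀ x, Tendsto (fun n => (MeasureTheory.convolution ((ρ n).normed volume) u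
      (ContinuousLinearMap.lsmul ℝ ℝ) volume) x) atTop (nhds (u x)) := fun x =>
    ContDiffBump.convolution_tendsto_right_of_continuous hρ hu x
  refine ⟨u 1 - u 0, u 0, fun x => ?_⟩
  refine tendsto_nhds_unique (lim x) ?_
  simp_rw [fun n => key (ρ n) x]
  exact (((lim 1).sub (lim 0)).mul_const x).add (lim 0)

end TestFunctions

/-! ### Second derivatives as differences of finite measures -/

/-- `f` is continuous and its second distributional derivative is `P - N`. -/
def WeakSecondDeriv (f : ℝ → ℝ) (P N : Measure ℝ) : Prop :=
  Continuous f ∧ ∀ φ : ℝ → ℝ, ContDiff ℝ ∞ φ → HasCompactSupport φ →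
    ∫ x, f x * iteratedDeriv 2 φ x = ∫ x, φ x ∂P - ∫ x, φ x ∂N

theorem integral_toSignedMeasure_sub {P N : Measure ℝ} [IsFiniteMeasure P] [IsFiniteMeasure N]
    {φ : ℝ → ℝ} (hP : Integrable φ P) (hN : Integrable φ N) :
    ∫ᵛ x, φ x ∂<•(P.toSignedMeasure - N.toSignedMeasure) = ∫ x, φ x ∂P - ∫ x, φ x ∂N := by
  rw [VectorMeasure.integral_sub_vectorMeasure, VectorMeasure.integral_toSignedMeasure,
    VectorMeasure.integral_toSignedMeasure]
  · rwa [VectorMeasure.Integrable, Measure.variation_toSignedMeasure]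
  · rwa [VectorMeasure.Integrable, Measure.variation_toSignedMeasure]

theorem HasSecondDeriv.weakSecondDeriv {f : ℝ → ℝ} {μ : SignedMeasure ℝ}
    (h : HasSecondDeriv f μ) :
    WeakSecondDeriv f μ.toJordanDecomposition.posPart μ.toJordanDecomposition.negPart := by
  refine ⟨h.1, fun φ hφ hc => ?_⟩
  rw [h.2 φ hφ hc]
  nth_rewrite 1 [← μ.toSignedMeasure_toJordanDecomposition]
  exact integral_toSignedMeasure_sub (hφ.continuous.integrable_of_hasCompactSupport hc)
    (hφ.continuous.integrable_of_hasCompactSupport hc)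

theorem WeakSecondDeriv.hasSecondDeriv {f : ℝ → ℝ} {P N : Measure ℝ} [IsFiniteMeasure P]
    [IsFiniteMeasure N] (h : WeakSecondDeriv f P N) :
    HasSecondDeriv f (P.toSignedMeasure - N.toSignedMeasure) := by
  refine ⟨h.1, fun φ hφ hc => ?_⟩
  rw [h.2 φ hφ hc, integral_toSignedMeasure_sub (hφ.continuous.integrable_of_hasCompactSupport hc)
    (hφ.continuous.integrable_of_hasCompactSupport hc)]

theorem WeakSecondDeriv.secondVariation_le {f : ℝ → ℝ} {P N : Measure ℝ} [IsFiniteMeasure P]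
    [IsFiniteMeasure N] (h : WeakSecondDeriv f P N) :
    secondVariation f ≤ P Set.univ + N Set.univ := by
  refine (iInf₂_le _ h.hasSecondDeriv).trans ?_
  rw [SignedMeasure.totalVariation_eq_variation]
  refine (VectorMeasure.variation_sub_le (μ := P.toSignedMeasure) (ν := N.toSignedMeasure)
    Set.univ).trans ?_
  simp

/-- Every bound above `∫ |f''|` is realized by a pair of finite measures. -/
theorem exists_weakSecondDeriv_of_secondVariation_lt {f : ℝ → ℝ} {c : ℝ≥0∞}
    (h : secondVariation f < c) :
    ∃ P N : Measure ℝ, IsFiniteMeasure P ∧ IsFiniteMeasure N ∧ WeakSecondDeriv f P N ∧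
      P Set.univ + N Set.univ < c := by
  unfold secondVariation at h
  simp only [iInf_lt_iff] at h
  obtain ⟨μ, hμ, hc⟩ := h
  exact ⟨_, _, inferInstance, inferInstance, hμ.weakSecondDeriv, hc⟩

/-! ### Representation by the fundamental solution -/

/-- Twice the fundamental solution of the second derivative with pole `t`, normalized to vanish
at the origin. -/
def greenKernel (x t : ℝ) : ℝ := |x - t| - |t|

theorem abs_greenKernel_le (x t : ℝ) : |greenKernel x t| ≤ |x| := by
  unfold greenKernel
  have := abs_abs_sub_abs_le_abs_sub (x - t) (-t)
  rw [abs_neg] at this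
  simpa using this

theorem continuous_greenKernel : Continuous fun p : ℝ × ℝ => greenKernel p.1 p.2 := by
  unfold greenKernel
  fun_prop

theorem integrable_greenKernel (P : Measure ℝ) [IsFiniteMeasure P] (x : ℝ) :
    Integrable (greenKernel x) P := by
  refine Integrable.of_bound (C := |x|) ?_ (ae_of_all _ fun t => abs_greenKernel_le x t)
  exact (continuous_greenKernel.comp (Continuous.prodMk_right x)).aestronglyMeasurable

theorem lipschitz_integral_greenKernel (P : Measure ℝ) [IsFiniteMeasure P] (x y : ℝ) :
    |∫ t, greenKernel x t ∂P - ∫ t, greenKernel y t ∂P| ≤ P.real Set.univ * |x - y| := by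
  rw [← integral_sub (integrable_greenKernel P x) (integrable_greenKernel P y)]
  have b : ∀ t, ‖greenKernel x t - greenKernel y t‖ ≤ |x - y| := fun t => by
    unfold greenKernel
    rw [Real.norm_eq_abs]
    simpa using abs_abs_sub_abs_le_abs_sub (x - t) (y - t)
  exact (norm_integral_le_of_norm_le_const (μ := P) (ae_of_all _ b)).trans (by rw [mul_comm])

theorem continuous_integral_greenKernel (P : Measure ℝ) [IsFiniteMeasure P] :
    Continuous fun x => ∫ t, greenKernel x t ∂P :=
  (LipschitzWith.of_dist_le_mul (K := (P.real Set.univ).toNNReal) fun x y => by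
    rw [Real.coe_toNNReal _ measureReal_nonneg]
    exact lipschitz_integral_greenKernel P x y).continuous

theorem integral_greenKernel_mul_iteratedDeriv_two {φ : ℝ → ℝ} (h : ContDiff ℝ ∞ φ)
    (hc : HasCompactSupport φ) (t : ℝ) :
    ∫ x, greenKernel x t * iteratedDeriv 2 φ x = 2 * φ t := by
  have h1 := integral_abs_sub_mul_iteratedDeriv_two h hc t
  have h2 := integral_affine_mul_iteratedDeriv_two h hc 0 |t|
  have i1 := integrable_mul_iteratedDeriv_two h hc (u := fun x => |x - t|) (by fun_prop)
  have i2 := integrable_mul_iteratedDeriv_two h hc (u := fun x => 0 * x + |t|) (by fun_prop)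
  rw [← h1, ← sub_zero (∫ x, |x - t| * iteratedDeriv 2 φ x), ← h2, ← integral_sub i1 i2]
  refine integral_congr_ae (ae_of_all _ fun x => ?_)
  simp only [greenKernel]
  ring

theorem integral_integral_greenKernel_mul (P : Measure ℝ) [IsFiniteMeasure P] {φ : ℝ → ℝ}
    (h : ContDiff ℝ ∞ φ) (hc : HasCompactSupport φ) :
    ∫ x, (∫ t, greenKernel x t ∂P) * iteratedDeriv 2 φ x = 2 * ∫ t, φ t ∂P := by
  have hcont : Continuous (iteratedDeriv 2 φ) := by
    rw [iteratedDeriv_two_eq]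
    exact h.deriv_infty.deriv_infty.continuous
  simp_rw [← integral_mul_const]
  rw [integral_integral_swap]
  · simp_rw [integral_greenKernel_mul_iteratedDeriv_two h hc]
    rw [integral_const_mul]
  · have i1 : Integrable (fun p : ℝ × ℝ => (p.1 * iteratedDeriv 2 φ p.1) * (1 : ℝ))
        (volume.prod P) :=
      (integrable_mul_iteratedDeriv_two h hc (u := fun x => x) continuous_id).mul_prod
        (integrable_const (1 : ℝ))
    refine i1.mono ?_ (ae_of_all _ fun p => ?_)
    · exact (continuous_greenKernel.mul (hcont.comp continuous_fst)).aestronglyMeasurable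
    · simp only [Function.uncurry, norm_mul, mul_one]
      exact mul_le_mul_of_nonneg_right (abs_greenKernel_le _ _) (norm_nonneg _)

/-- `f` has the second derivative `P - N`, in integrated form. -/
def GreenRepr (f : ℝ → ℝ) (a b : ℝ) (P N : Measure ℝ) : Prop :=
  ∀ x, f x = a * x + b + (∫ t, greenKernel x t ∂P - ∫ t, greenKernel x t ∂N) / 2

theorem GreenRepr.weakSecondDeriv {f : ℝ → ℝ} {a b : ℝ} {P N : Measure ℝ} [IsFiniteMeasure P]
    [IsFiniteMeasure N] (hf : GreenRepr f a b P N) : WeakSecondDeriv f P N := by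
  have cP := continuous_integral_greenKernel P
  have cN := continuous_integral_greenKernel N
  refine ⟨?_, fun φ h hc => ?_⟩
  · rw [funext hf]
    fun_prop
  · have iP := integrable_mul_iteratedDeriv_two h hc cP
    have iN := integrable_mul_iteratedDeriv_two h hc cN
    have ia := integrable_mul_iteratedDeriv_two h hc (u := fun x => a * x + b) (by fun_prop)
    have e : ∀ x, f x * iteratedDeriv 2 φ x = (a * x + b) * iteratedDeriv 2 φ x +
        ((∫ t, greenKernel x t ∂P) * iteratedDeriv 2 φ x -
          (∫ t, greenKernel x t ∂N) * iteratedDeriv 2 φ x) / 2 := fun x => by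
      rw [hf x]
      ring
    simp_rw [e]
    rw [integral_add ia ((iP.sub' iN).div_const 2), integral_div, integral_sub iP iN,
      integral_integral_greenKernel_mul P h hc, integral_integral_greenKernel_mul N h hc,
      integral_affine_mul_iteratedDeriv_two h hc]
    ring

theorem WeakSecondDeriv.exists_greenRepr {f : ℝ → ℝ} {P N : Measure ℝ} [IsFiniteMeasure P]
    [IsFiniteMeasure N] (hf : WeakSecondDeriv f P N) : ∃ a b, GreenRepr f a b P N := by
  set g : ℝ → ℝ := fun x => (∫ t, greenKernel x t ∂P - ∫ t, greenKernel x t ∂N) / 2 with hg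
  have hg' : WeakSecondDeriv g P N := GreenRepr.weakSecondDeriv (a := 0) (b := 0)
    (fun x => by simp [hg])
  obtain ⟨a, b, hab⟩ := exists_affine_of_integral_mul_iteratedDeriv_two_eq_zero
    (u := fun x => f x - g x) (hf.1.sub hg'.1) (fun φ h hc => by
      simp_rw [sub_mul]
      rw [integral_sub (integrable_mul_iteratedDeriv_two h hc hf.1)
        (integrable_mul_iteratedDeriv_two h hc hg'.1), hf.2 φ h hc, hg'.2 φ h hc, sub_self])
  exact ⟨a, b, fun x => by
    have := hab x
    simp only [hg] at this
    linarith⟩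

/-! ### Asymptotic slopes -/

theorem integral_greenKernel_tail_right (P : Measure ℝ) [IsFiniteMeasure P] {M x y : ℝ}
    (hx : M ≤ x) (hy : M ≤ y) :
    |∫ t, greenKernel y t ∂P - ∫ t, greenKernel x t ∂P - P.real Set.univ * (y - x)| ≤
      2 * P.real (Set.Ioi M) * |y - x| := by
  have i1 := integrable_greenKernel P y
  have i2 := integrable_greenKernel P x
  have e : ∫ t, greenKernel y t ∂P - ∫ t, greenKernel x t ∂P - P.real Set.univ * (y - x) =
      ∫ t, (greenKernel y t - greenKernel x t - (y - x)) ∂P := by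
    rw [integral_sub (i1.sub' i2) (integrable_const _), integral_sub i1 i2, integral_const,
      smul_eq_mul]
  rw [e]
  have b : ∀ t, ‖greenKernel y t - greenKernel x t - (y - x)‖ ≤
      (Set.Ioi M).indicator (fun _ => 2 * |y - x|) t := by
    intro t
    rw [Real.norm_eq_abs]
    unfold greenKernel
    by_cases ht : t ∈ Set.Ioi M
    · rw [Set.indicator_of_mem ht]
      have h1 := abs_abs_sub_abs_le_abs_sub (y - t) (x - t)
      have h2 : y - t - (x - t) = y - x := by ring
      rw [h2] at h1
      calc |(|y - t| - |t| - (|x - t| - |t|) - (y - x))|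
          = |(|y - t| - |x - t|) - (y - x)| := by ring_nf
        _ ≤ _ := (abs_sub _ _).trans (by linarith)
    · rw [Set.indicator_of_notMem ht]
      simp only [Set.mem_Ioi, not_lt] at ht
      rw [abs_of_nonneg (by linarith : 0 ≤ y - t), abs_of_nonneg (by linarith : 0 ≤ x - t)]
      simp
  refine (norm_integral_le_of_norm_le ((integrable_const _).indicator measurableSet_Ioi)
    (ae_of_all _ b)).trans ?_
  rw [integral_indicator measurableSet_Ioi, setIntegral_const, smul_eq_mul]
  exact le_of_eq (by ring)

theorem integral_greenKernel_tail_left (P : Measure ℝ) [IsFiniteMeasure P] {M x y : ℝ}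
    (hx : x ≤ M) (hy : y ≤ M) :
    |∫ t, greenKernel y t ∂P - ∫ t, greenKernel x t ∂P + P.real Set.univ * (y - x)| ≤
      2 * P.real (Set.Iio M) * |y - x| := by
  have i1 := integrable_greenKernel P y
  have i2 := integrable_greenKernel P x
  have e : ∫ t, greenKernel y t ∂P - ∫ t, greenKernel x t ∂P + P.real Set.univ * (y - x) =
      ∫ t, (greenKernel y t - greenKernel x t + (y - x)) ∂P := by
    rw [integral_add (i1.sub' i2) (integrable_const _), integral_sub i1 i2, integral_const,
      smul_eq_mul]
  rw [e]
  have b : ∀ t, ‖greenKernel y t - greenKernel x t + (y - x)‖ ≤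
      (Set.Iio M).indicator (fun _ => 2 * |y - x|) t := by
    intro t
    rw [Real.norm_eq_abs]
    unfold greenKernel
    by_cases ht : t ∈ Set.Iio M
    · rw [Set.indicator_of_mem ht]
      have h1 := abs_abs_sub_abs_le_abs_sub (y - t) (x - t)
      have h2 : y - t - (x - t) = y - x := by ring
      rw [h2] at h1
      calc |(|y - t| - |t| - (|x - t| - |t|) + (y - x))|
          = |(|y - t| - |x - t|) + (y - x)| := by ring_nf
        _ ≤ _ := (abs_add_le _ _).trans (by linarith)
    · rw [Set.indicator_of_notMem ht]
      simp only [Set.mem_Iio, not_lt] at ht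
      rw [abs_of_nonpos (by linarith : y - t ≤ 0), abs_of_nonpos (by linarith : x - t ≤ 0)]
      ring_nf
      simp
  refine (norm_integral_le_of_norm_le ((integrable_const _).indicator measurableSet_Iio)
    (ae_of_all _ b)).trans ?_
  rw [integral_indicator measurableSet_Iio, setIntegral_const, smul_eq_mul]
  exact le_of_eq (by ring)

section Slopes

variable {f : ℝ → ℝ} {a b : ℝ} {P N : Measure ℝ} [IsFiniteMeasure P] [IsFiniteMeasure N]

theorem GreenRepr.tail_right (hf : GreenRepr f a b P N) {M x y : ℝ} (hx : M ≤ x) (hy : M ≤ y) :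
    |f y - f x - (a + (P.real Set.univ - N.real Set.univ) / 2) * (y - x)| ≤
      (P + N).real (Set.Ioi M) * |y - x| := by
  have h1 := integral_greenKernel_tail_right P hx hy
  have h2 := integral_greenKernel_tail_right N hx hy
  rw [measureReal_add_apply]
  have e : f y - f x - (a + (P.real Set.univ - N.real Set.univ) / 2) * (y - x) =
      (∫ t, greenKernel y t ∂P - ∫ t, greenKernel x t ∂P - P.real Set.univ * (y - x)) / 2 -
      (∫ t, greenKernel y t ∂N - ∫ t, greenKernel x t ∂N - N.real Set.univ * (y - x)) / 2 := by
    rw [hf x, hf y]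
    ring
  rw [e]
  refine (abs_sub _ _).trans ?_
  rw [abs_div, abs_div, abs_two]
  linarith

theorem GreenRepr.tail_left (hf : GreenRepr f a b P N) {M x y : ℝ} (hx : x ≤ M) (hy : y ≤ M) :
    |f y - f x - (a - (P.real Set.univ - N.real Set.univ) / 2) * (y - x)| ≤
      (P + N).real (Set.Iio M) * |y - x| := by
  have h1 := integral_greenKernel_tail_left P hx hy
  have h2 := integral_greenKernel_tail_left N hx hy
  rw [measureReal_add_apply]
  have e : f y - f x - (a - (P.real Set.univ - N.real Set.univ) / 2) * (y - x) =
      (∫ t, greenKernel y t ∂P - ∫ t, greenKernel x t ∂P + P.real Set.univ * (y - x)) / 2 -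
      (∫ t, greenKernel y t ∂N - ∫ t, greenKernel x t ∂N + N.real Set.univ * (y - x)) / 2 := by
    rw [hf x, hf y]
    ring
  rw [e]
  refine (abs_sub _ _).trans ?_
  rw [abs_div, abs_div, abs_two]
  linarith

end Slopes

theorem tendsto_measureReal_Ioi (P : Measure ℝ) [IsFiniteMeasure P] :
    Tendsto (fun M => P.real (Set.Ioi M)) atTop (nhds 0) := by
  have h := tendsto_measure_iInter_atTop (μ := P) (s := fun M : ℝ => Set.Ioi M)
    (fun _ => measurableSet_Ioi.nullMeasurableSet) (fun _ _ h => Set.Ioi_subset_Ioi h)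
    ⟨0, measure_ne_top _ _⟩
  have e : ⋂ M : ℝ, Set.Ioi M = ∅ := by
    ext x
    simpa using ⟨x, le_rfl⟩
  rw [e, measure_empty] at h
  exact (ENNReal.tendsto_toReal ENNReal.zero_ne_top).comp h

theorem tendsto_measureReal_Iio (P : Measure ℝ) [IsFiniteMeasure P] :
    Tendsto (fun M => P.real (Set.Iio M)) atBot (nhds 0) := by
  have h := tendsto_measure_iInter_atBot (μ := P) (s := fun M : ℝ => Set.Iio M)
    (fun _ => measurableSet_Iio.nullMeasurableSet) (fun _ _ h => Set.Iio_subset_Iio h)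
    ⟨0, measure_ne_top _ _⟩
  have e : ⋂ M : ℝ, Set.Iio M = ∅ := by
    ext x
    simpa using ⟨x, le_rfl⟩
  rw [e, measure_empty] at h
  exact (ENNReal.tendsto_toReal ENNReal.zero_ne_top).comp h

/-- A function that is `δ`-close in Lipschitz norm to the line of slope `s` near a point where it
is differentiable has a derivative `δ`-close to `s`. -/
theorem abs_deriv_sub_le {f : ℝ → ℝ} {x s δ : ℝ} (hd : DifferentiableAt ℝ f x)
    (h : ∀ᶠ y in nhds x, |f y - f x - s * (y - x)| ≤ δ * |y - x|) : |deriv f x - s| ≤ δ := by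
  have hg : HasDerivAt (fun y => f y - s * y) (deriv f x - s) x := by
    refine (hd.hasDerivAt.sub ((hasDerivAt_id x).const_mul s)).congr_deriv ?_
    simp
  have hδ : 0 ≤ δ := by
    obtain ⟨y, hy, hxy⟩ := ((h.filter_mono nhdsWithin_le_nhds).and
      (self_mem_nhdsWithin (a := x) (s := {x}ᶜ))).exists
    have hp : 0 < |y - x| := abs_pos.2 (sub_ne_zero.2 hxy)
    by_contra hneg
    push Not at hneg
    nlinarith [abs_nonneg (f y - f x - s * (y - x))]
  refine hg.le_of_lip' hδ ?_
  filter_upwards [h] with y hy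
  rw [Real.norm_eq_abs, Real.norm_eq_abs]
  convert hy using 2
  ring

theorem derivLim_eq_of_tendsto {l : Filter ℝ} {f : ℝ → ℝ} {s : ℝ}
    (hne : (l ⊓ 𝓟 {x | DifferentiableAt ℝ f x}).NeBot)
    (h : ∀ δ > 0, ∀ᶠ x in l, DifferentiableAt ℝ f x → |deriv f x - s| ≤ δ) :
    derivLim l f = s := by
  refine Tendsto.limUnder_eq (Metric.tendsto_nhds.2 fun ε hε => ?_)
  rw [eventually_inf_principal]
  filter_upwards [h (ε / 2) (by positivity)] with x hx hd
  rw [Real.dist_eq]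
  linarith [hx hd]

section Slopes

variable {f : ℝ → ℝ} {a b : ℝ} {P N : Measure ℝ} [IsFiniteMeasure P] [IsFiniteMeasure N]

theorem GreenRepr.dense_differentiableAt (hf : GreenRepr f a b P N) :
    Dense {x | DifferentiableAt ℝ f x} := by
  have hl : LipschitzWith (|a| + (P.real Set.univ + N.real Set.univ) / 2).toNNReal f := by
    refine LipschitzWith.of_dist_le_mul fun x y => ?_
    have hP := lipschitz_integral_greenKernel P x y
    have hN := lipschitz_integral_greenKernel N x y
    rw [Real.coe_toNNReal _ (by positivity), Real.dist_eq, Real.dist_eq]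
    have e : f x - f y = a * (x - y) +
        ((∫ t, greenKernel x t ∂P - ∫ t, greenKernel y t ∂P) / 2 -
        (∫ t, greenKernel x t ∂N - ∫ t, greenKernel y t ∂N) / 2) := by
      rw [hf x, hf y]
      ring
    rw [e]
    refine (abs_add_le _ _).trans ?_
    have := abs_sub ((∫ t, greenKernel x t ∂P - ∫ t, greenKernel y t ∂P) / 2)
      ((∫ t, greenKernel x t ∂N - ∫ t, greenKernel y t ∂N) / 2)
    rw [abs_div, abs_div, abs_two] at this
    rw [abs_mul]
    linarith
  exact Measure.dense_of_ae hl.ae_differentiableAt_real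

theorem GreenRepr.derivLim_atTop (hf : GreenRepr f a b P N) :
    derivLim atTop f = a + (P.real Set.univ - N.real Set.univ) / 2 := by
  refine derivLim_eq_of_tendsto ?_ fun δ hδ => ?_
  · rw [← frequently_mem_iff_neBot, frequently_atTop]
    intro M
    obtain ⟨x, hx, hM⟩ := hf.dense_differentiableAt.exists_mem_open isOpen_Ioi
      (Set.nonempty_Ioi (a := M))
    exact ⟨x, hM.le, hx⟩
  · obtain ⟨M, hM⟩ := ((tendsto_measureReal_Ioi (P + N)).eventually (gt_mem_nhds hδ)).exists
    filter_upwards [eventually_gt_atTop M] with x hx hd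
    refine abs_deriv_sub_le hd ?_
    filter_upwards [lt_mem_nhds hx] with y hy
    exact (hf.tail_right hx.le hy.le).trans (by gcongr)

theorem GreenRepr.derivLim_atBot (hf : GreenRepr f a b P N) :
    derivLim atBot f = a - (P.real Set.univ - N.real Set.univ) / 2 := by
  refine derivLim_eq_of_tendsto ?_ fun δ hδ => ?_
  · rw [← frequently_mem_iff_neBot, frequently_atBot]
    intro M
    obtain ⟨x, hx, hM⟩ := hf.dense_differentiableAt.exists_mem_open isOpen_Iio
      (Set.nonempty_Iio (a := M))
    exact ⟨x, hM.le, hx⟩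
  · obtain ⟨M, hM⟩ := ((tendsto_measureReal_Iio (P + N)).eventually (gt_mem_nhds hδ)).exists
    filter_upwards [eventually_lt_atBot M] with x hx hd
    refine abs_deriv_sub_le hd ?_
    filter_upwards [gt_mem_nhds hx] with y hy
    exact (hf.tail_left hx.le hy.le).trans (by gcongr)

theorem GreenRepr.derivLim_add (hf : GreenRepr f a b P N) :
    derivLim atBot f + derivLim atTop f = 2 * a := by
  rw [hf.derivLim_atBot, hf.derivLim_atTop]
  ring

end Slopes

/-! ### Piecewise affine functions -/

/-- `f` is the sum of an affine function with linear part `a` and of multiples `c t / 2` of the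
functions `|x - t|`, for `t` in `T`. -/
def KinkForm (f : ℝ → ℝ) (T : Finset ℝ) (c : ℝ → ℝ) (a b : ℝ) : Prop :=
  ∀ x, f x = a * x + b + (∑ t ∈ T, c t * |x - t|) / 2

theorem relu_unit_eq (w₁ b₁ w₂ x : ℝ) :
    w₂ * max 0 (w₁ * x + b₁) = w₂ * w₁ / 2 * x +
      (if w₁ = 0 then w₂ * max 0 b₁ else w₂ * b₁ / 2) + w₂ * |w₁| * |x - -b₁ / w₁| / 2 := by
  split_ifs with h
  · simp [h]
  · have e : |w₁| * |x - -b₁ / w₁| = |w₁ * x + b₁| := by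
      rw [← abs_mul]
      congr 1
      field_simp
      ring
    rw [mul_assoc w₂, e]
    rcases le_total 0 (w₁ * x + b₁) with h0 | h0
    · rw [max_eq_right h0, abs_of_nonneg h0]
      ring
    · rw [max_eq_left h0, abs_of_nonpos h0]
      ring

theorem ReLUNet.cost_nonneg (θ : ReLUNet) : 0 ≤ θ.cost := by
  unfold ReLUNet.cost
  positivity

theorem ReLUNet.sum_abs_mul_le_cost (θ : ReLUNet) : ∑ i, |θ.w₂ i * θ.w₁ i| ≤ θ.cost := by
  unfold ReLUNet.cost
  rw [Finset.mul_sum]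
  refine Finset.sum_le_sum fun i _ => ?_
  rw [abs_le]
  constructor <;> nlinarith [sq_nonneg (θ.w₂ i + θ.w₁ i), sq_nonneg (θ.w₂ i - θ.w₁ i)]

theorem ReLUNet.exists_kinkForm (θ : ReLUNet) :
    ∃ (T : Finset ℝ) (c : ℝ → ℝ) (a b : ℝ), KinkForm θ.toFun T c a b ∧
      ∑ t ∈ T, |c t| ≤ θ.cost ∧ 2 * |a| ≤ θ.cost := by
  classical
  set τ : Fin θ.k → ℝ := fun i => -θ.b₁ i / θ.w₁ i
  set C : Fin θ.k → ℝ := fun i => θ.w₂ i * |θ.w₁ i|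
  have hmaps : ∀ i ∈ (Finset.univ : Finset (Fin θ.k)), τ i ∈ Finset.univ.image τ :=
    fun i hi => Finset.mem_image_of_mem τ hi
  refine ⟨Finset.univ.image τ, fun s => ∑ i with τ i = s, C i, ∑ i, θ.w₂ i * θ.w₁ i / 2,
    (∑ i, if θ.w₁ i = 0 then θ.w₂ i * max 0 (θ.b₁ i) else θ.w₂ i * θ.b₁ i / 2) + θ.b₂, ?_, ?_, ?_⟩
  · intro x
    have e : ∑ t ∈ Finset.univ.image τ, (∑ i with τ i = t, C i) * |x - t| =
        ∑ i, C i * |x - τ i| := by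
      rw [← Finset.sum_fiberwise_of_maps_to hmaps]
      refine Finset.sum_congr rfl fun t _ => ?_
      rw [Finset.sum_mul]
      refine Finset.sum_congr rfl fun i hi => ?_
      rw [(Finset.mem_filter.1 hi).2]
    rw [e, ReLUNet.toFun]
    simp_rw [relu_unit_eq]
    rw [Finset.sum_add_distrib, Finset.sum_add_distrib, Finset.sum_mul, Finset.sum_div]
    ring
  · calc ∑ t ∈ Finset.univ.image τ, |∑ i with τ i = t, C i|
        ≤ ∑ t ∈ Finset.univ.image τ, ∑ i with τ i = t, |C i| :=
          Finset.sum_le_sum fun t _ => Finset.abs_sum_le_sum_abs _ _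
      _ = ∑ i, |C i| := Finset.sum_fiberwise_of_maps_to hmaps _
      _ = ∑ i, |θ.w₂ i * θ.w₁ i| := by simp [C, abs_mul]
      _ ≤ _ := θ.sum_abs_mul_le_cost
  · rw [← Finset.sum_div, abs_div, abs_two]
    linarith [θ.sum_abs_mul_le_cost,
      Finset.abs_sum_le_sum_abs (fun i => θ.w₂ i * θ.w₁ i) Finset.univ]

section KinkForm

variable {f : ℝ → ℝ} {T : Finset ℝ} {c : ℝ → ℝ} {a b : ℝ}

/-- The point masses `max 0 (c t)` at the points `t` of `T`. -/
def pointMasses (T : Finset ℝ) (c : ℝ → ℝ) : Measure ℝ :=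
  ∑ t ∈ T, ENNReal.ofReal (c t) • Measure.dirac t

instance isFiniteMeasure_pointMasses (T : Finset ℝ) (c : ℝ → ℝ) :
    IsFiniteMeasure (pointMasses T c) := by
  refine ⟨?_⟩
  simp [pointMasses, ENNReal.sum_lt_top]

theorem integral_pointMasses (T : Finset ℝ) (c φ : ℝ → ℝ) :
    ∫ x, φ x ∂pointMasses T c = ∑ t ∈ T, max (c t) 0 * φ t := by
  unfold pointMasses
  rw [integral_finsetSum_measure fun t _ => (integrable_dirac (by simp)).smul_measure (by simp)]
  refine Finset.sum_congr rfl fun t _ => ?_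
  rw [integral_smul_measure, integral_dirac, ENNReal.toReal_ofReal', smul_eq_mul]

theorem integral_pointMasses_sub (T : Finset ℝ) (c φ : ℝ → ℝ) :
    ∫ x, φ x ∂pointMasses T c - ∫ x, φ x ∂pointMasses T (-c) = ∑ t ∈ T, c t * φ t := by
  rw [integral_pointMasses, integral_pointMasses, ← Finset.sum_sub_distrib]
  refine Finset.sum_congr rfl fun t _ => ?_
  rw [← sub_mul]
  congr 1
  simp only [Pi.neg_apply]
  rcases le_total 0 (c t) with h | h
  · rw [max_eq_left h, max_eq_right (by linarith), sub_zero]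
  · rw [max_eq_right h, max_eq_left (by linarith), zero_sub, neg_neg]

theorem pointMasses_univ_add (T : Finset ℝ) (c : ℝ → ℝ) :
    pointMasses T c Set.univ + pointMasses T (-c) Set.univ =
      ENNReal.ofReal (∑ t ∈ T, |c t|) := by
  rw [ENNReal.ofReal_sum_of_nonneg fun t _ => abs_nonneg _]
  simp only [pointMasses, Measure.coe_finsetSum, Finset.sum_apply, Measure.smul_apply,
    measure_univ, smul_eq_mul, mul_one, ← Finset.sum_add_distrib, Pi.neg_apply]
  refine Finset.sum_congr rfl fun t _ => ?_
  rcases le_total 0 (c t) with h | h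
  · rw [abs_of_nonneg h, ENNReal.ofReal_of_nonpos (by linarith : -c t ≤ 0), add_zero]
  · rw [abs_of_nonpos h, ENNReal.ofReal_of_nonpos h, zero_add]

theorem KinkForm.greenRepr (h : KinkForm f T c a b) :
    GreenRepr f a (b + (∑ t ∈ T, c t * |t|) / 2) (pointMasses T c) (pointMasses T (-c)) := by
  intro x
  rw [integral_pointMasses_sub, h x]
  simp only [greenKernel, mul_sub, Finset.sum_sub_distrib]
  ring

theorem KinkForm.derivLim_add (h : KinkForm f T c a b) :
    derivLim atBot f + derivLim atTop f = 2 * a :=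
  h.greenRepr.derivLim_add

theorem KinkForm.penalty_le (h : KinkForm f T c a b) :
    penalty f ≤ ENNReal.ofReal (max (∑ t ∈ T, |c t|) (2 * |a|)) := by
  unfold penalty
  rw [ENNReal.ofReal_max, h.derivLim_add, abs_mul, abs_two, ← pointMasses_univ_add]
  exact max_le_max h.greenRepr.weakSecondDeriv.secondVariation_le le_rfl

/-- There is a test function with values in `[-1, 1]` and prescribed signs on a finite set. -/
theorem exists_testFunction_eq_sign (T : Finset ℝ) (c : ℝ → ℝ) :
    ∃ φ : ℝ → ℝ, ContDiff ℝ ∞ φ ∧ HasCompactSupport φ ∧ (∀ x, |φ x| ≤ 1) ∧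
      ∀ t ∈ T, c t * φ t = |c t| := by
  classical
  have fin : ∀ S : Finset ℝ, IsClosed (S : Set ℝ) := fun S => S.finite_toSet.isClosed
  obtain ⟨u, hu0, hu1, hu⟩ := exists_contMDiffMap_zero_one_of_isClosed (n := ⊤)
    (modelWithCornersSelf ℝ ℝ) (fin (T.filter fun t => c t < 0)) (fin (T.filter fun t => 0 ≤ c t))
    (by
      rw [Finset.disjoint_coe, Finset.disjoint_filter]
      intro t _ h
      exact not_le.2 h)
  obtain ⟨R, hR, hTR⟩ := (T.finite_toSet.isBounded (α := ℝ)).subset_ball_lt 0 0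
  let χ : ContDiffBump (0 : ℝ) := ⟨R, R + 1, hR, by linarith⟩
  have hus : ContDiff ℝ ∞ u := u.contMDiff.contDiff
  refine ⟨fun x => (2 * u x - 1) * χ x, ?_, ?_, ?_, ?_⟩
  · exact ((contDiff_const.mul hus).sub contDiff_const).mul χ.contDiff
  · exact χ.hasCompactSupport.mul_left
  · intro x
    rw [abs_mul, abs_of_nonneg χ.nonneg]
    have h1 : |2 * u x - 1| ≤ 1 := by
      rw [abs_le]
      constructor <;> linarith [(hu x).1, (hu x).2]
    exact mul_le_one₀ h1 χ.nonneg χ.le_one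
  · intro t ht
    have e : χ t = 1 := χ.one_of_mem_closedBall (Metric.ball_subset_closedBall (hTR ht))
    simp only [e, mul_one]
    rcases lt_or_ge (c t) 0 with h | h
    · rw [hu0 (by simp [ht, h] : t ∈ _), abs_of_neg h]
      simp
    · rw [hu1 (by simp [ht, h] : t ∈ _), abs_of_nonneg h]
      norm_num

theorem KinkForm.sum_abs_le (h : KinkForm f T c a b) {P N : Measure ℝ} [IsFiniteMeasure P]
    [IsFiniteMeasure N] (hf : WeakSecondDeriv f P N) :
    ENNReal.ofReal (∑ t ∈ T, |c t|) ≤ P Set.univ + N Set.univ := by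
  obtain ⟨φ, hφ, hc, h1, hs⟩ := exists_testFunction_eq_sign T c
  have e1 := hf.2 φ hφ hc
  rw [h.greenRepr.weakSecondDeriv.2 φ hφ hc, integral_pointMasses_sub, Finset.sum_congr rfl hs]
    at e1
  have bd : ∀ Q : Measure ℝ, IsFiniteMeasure Q → |∫ x, φ x ∂Q| ≤ Q.real Set.univ := fun Q _ => by
    simpa using norm_integral_le_of_norm_le_const (μ := Q) (f := φ) (C := 1) (ae_of_all _ h1)
  have bP := abs_le.1 (bd P inferInstance)
  have bN := abs_le.1 (bd N inferInstance)
  rw [← ENNReal.ofReal_toReal (measure_ne_top P Set.univ),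
    ← ENNReal.ofReal_toReal (measure_ne_top N Set.univ), ← ENNReal.ofReal_add (by simp) (by simp)]
  refine ENNReal.ofReal_le_ofReal ?_
  simp only [measureReal_def] at bP bN
  linarith

theorem KinkForm.le_penalty (h : KinkForm f T c a b) :
    ENNReal.ofReal (max (∑ t ∈ T, |c t|) (2 * |a|)) ≤ penalty f := by
  unfold penalty
  rw [ENNReal.ofReal_max, h.derivLim_add, abs_mul, abs_two]
  refine max_le_max (le_of_forall_gt fun d hd => ?_) le_rfl
  obtain ⟨P, N, _, _, hw, hlt⟩ := exists_weakSecondDeriv_of_secondVariation_lt hd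
  exact (h.sum_abs_le hw).trans_lt hlt

end KinkForm

theorem ReLUNet.penalty_le_cost (θ : ReLUNet) : penalty θ.toFun ≤ ENNReal.ofReal θ.cost := by
  obtain ⟨T, c, a, b, h, h1, h2⟩ := θ.exists_kinkForm
  exact h.penalty_le.trans (ENNReal.ofReal_le_ofReal (max_le h1 h2))

/-! ### Networks of least cost -/

/-- `f` is computed by a network of cost at most `C`. -/
def CostLE (f : ℝ → ℝ) (C : ℝ) : Prop := ∃ θ : ReLUNet, θ.toFun = f ∧ θ.cost ≤ C

theorem CostLE.mono {f : ℝ → ℝ} {C D : ℝ} (h : CostLE f C) (hCD : C ≤ D) : CostLE f D := by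
  obtain ⟨θ, h1, h2⟩ := h
  exact ⟨θ, h1, h2.trans hCD⟩

theorem CostLE.add {f g : ℝ → ℝ} {C D : ℝ} (hf : CostLE f C) (hg : CostLE g D) :
    CostLE (fun x => f x + g x) (C + D) := by
  obtain ⟨θ, rfl, h1⟩ := hf
  obtain ⟨η, rfl, h2⟩ := hg
  refine ⟨⟨θ.k + η.k, Fin.append θ.w₁ η.w₁, Fin.append θ.b₁ η.b₁, Fin.append θ.w₂ η.w₂,
    θ.b₂ + η.b₂⟩, ?_, ?_⟩
  · funext x
    simp only [ReLUNet.toFun, Fin.sum_univ_add, Fin.append_left, Fin.append_right]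
    ring
  · simp only [ReLUNet.cost, Fin.sum_univ_add, Fin.append_left, Fin.append_right] at h1 h2 ⊢
    linarith

theorem CostLE.const (b : ℝ) : CostLE (fun _ => b) 0 :=
  ⟨⟨0, 0, 0, 0, b⟩, by simp [ReLUNet.toFun, funext_iff], by simp [ReLUNet.cost]⟩

theorem CostLE.sum {ι : Type*} (s : Finset ι) {f : ι → ℝ → ℝ} {C : ι → ℝ}
    (h : ∀ i ∈ s, CostLE (f i) (C i)) : CostLE (fun x => ∑ i ∈ s, f i x) (∑ i ∈ s, C i) := by
  classical
  induction s using Finset.induction_on with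
  | empty => simpa using CostLE.const 0
  | insert i s hi ih =>
    simp only [Finset.sum_insert hi]
    exact (h i (by simp)).add (ih fun j hj => h j (by simp [hj]))

theorem CostLE.relu (p σ t : ℝ) (hσ : σ ^ 2 = 1) :
    CostLE (fun x => p * max 0 (σ * (x - t))) |p| := by
  refine ⟨⟨1, fun _ => √|p| * σ, fun _ => -(√|p| * σ * t), fun _ => SignType.sign p * √|p|, 0⟩,
    ?_, ?_⟩
  · funext x
    have e : √|p| * σ * x + -(√|p| * σ * t) = √|p| * (σ * (x - t)) := by ring
    simp only [ReLUNet.toFun, Finset.univ_unique, Finset.sum_const, Finset.card_singleton,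
      one_smul, add_zero]
    have e2 : max 0 (√|p| * (σ * (x - t))) = √|p| * max 0 (σ * (x - t)) := by
      rw [mul_max_of_nonneg _ _ (Real.sqrt_nonneg _), mul_zero]
    rw [e, e2]
    calc (SignType.sign p : ℝ) * √|p| * (√|p| * max 0 (σ * (x - t)))
        = (SignType.sign p : ℝ) * (√|p| * √|p|) * max 0 (σ * (x - t)) := by ring
      _ = _ := by rw [Real.mul_self_sqrt (abs_nonneg p), sign_mul_abs]
  · have hs : ((SignType.sign p : ℝ)) ^ 2 ≤ 1 := by
      rcases lt_trichotomy p 0 with h | h | h <;> simp [h]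
    simp only [ReLUNet.cost, Finset.univ_unique, Finset.sum_const, Finset.card_singleton, one_smul]
    rw [mul_pow, mul_pow, Real.sq_sqrt (abs_nonneg p), hσ]
    nlinarith [abs_nonneg p]

theorem CostLE.linear (γ : ℝ) : CostLE (fun x => γ * x) (2 * |γ|) := by
  have h := (CostLE.relu γ 1 0 (by norm_num)).add (CostLE.relu (-γ) (-1) 0 (by norm_num))
  rw [abs_neg, ← two_mul] at h
  convert h using 2 with x
  rcases le_total 0 x with hx | hx
  · rw [max_eq_right (by linarith), max_eq_left (by linarith)]
    ring
  · rw [max_eq_left (by linarith), max_eq_right (by linarith)]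
    ring

/-- A kink can be tilted at no cost. -/
theorem CostLE.kink (c s t : ℝ) (hs : |s| ≤ 1) :
    CostLE (fun x => c * |x - t| / 2 + s * |c| * (x - t) / 2) |c| := by
  have h := (CostLE.relu ((c + s * |c|) / 2) 1 t (by norm_num)).add
    (CostLE.relu ((c - s * |c|) / 2) (-1) t (by norm_num))
  have e : |(c + s * |c|) / 2| + |(c - s * |c|) / 2| = |c| := by
    have hb : |s * (|c|)| ≤ |c| := by
      rw [abs_mul, abs_abs]
      exact mul_le_of_le_one_left (abs_nonneg _) hs
    obtain ⟨h1, h2⟩ := abs_le.1 hb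
    rcases le_total 0 c with hc | hc
    · rw [abs_of_nonneg hc] at *
      rw [abs_of_nonneg (by linarith), abs_of_nonneg (by linarith)]
      ring
    · rw [abs_of_nonpos hc] at *
      rw [abs_of_nonpos (by linarith), abs_of_nonpos (by linarith)]
      ring
  rw [e] at h
  convert h using 2 with x
  rcases le_total 0 (x - t) with hx | hx
  · rw [abs_of_nonneg hx, max_eq_right (by linarith), max_eq_left (by linarith)]
    ring
  · rw [abs_of_nonpos hx, max_eq_left (by linarith), max_eq_right (by linarith)]
    ring

theorem exists_tilt (S a : ℝ) (hS : 0 ≤ S) :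
    ∃ s : ℝ, |s| ≤ 1 ∧ S + 2 * |a - s * S / 2| ≤ max S (2 * |a|) := by
  rcases le_or_gt (2 * |a|) S with h | h
  · rcases hS.eq_or_lt with h0 | h0
    · refine ⟨0, by simp, ?_⟩
      simp [← h0]
    · refine ⟨2 * a / S, ?_, ?_⟩
      · rw [abs_div, abs_mul, abs_two, abs_of_pos h0]
        exact div_le_one_of_le₀ h h0.le
      · rw [div_mul_cancel₀ _ h0.ne']
        simp
  · rcases le_total 0 a with ha | ha
    · rw [abs_of_nonneg ha] at *
      refine ⟨1, by simp, ?_⟩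
      rw [abs_of_nonneg (by linarith)]
      exact le_max_of_le_right (by linarith)
    · rw [abs_of_nonpos ha] at *
      refine ⟨-1, by simp, ?_⟩
      rw [abs_of_nonpos (by linarith)]
      exact le_max_of_le_right (by linarith)

theorem KinkForm.costLE {f : ℝ → ℝ} {T : Finset ℝ} {c : ℝ → ℝ} {a b : ℝ}
    (h : KinkForm f T c a b) : CostLE f (max (∑ t ∈ T, |c t|) (2 * |a|)) := by
  obtain ⟨s, hs, hle⟩ := exists_tilt (∑ t ∈ T, |c t|) a (Finset.sum_nonneg fun _ _ => abs_nonneg _)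
  have h1 := ((CostLE.sum T fun t _ => CostLE.kink (c t) s t hs).add
    (CostLE.linear (a - s * (∑ t ∈ T, |c t|) / 2))).add
    (CostLE.const (b + s * (∑ t ∈ T, |c t| * t) / 2))
  rw [add_zero] at h1
  refine CostLE.mono ?_ hle
  convert h1 using 2 with x
  rw [h x, Finset.sum_add_distrib, ← Finset.sum_div, ← Finset.sum_div]
  have e : ∑ t ∈ T, s * |c t| * (x - t) = s * (∑ t ∈ T, |c t|) * x - s * ∑ t ∈ T, |c t| * t := by
    rw [Finset.mul_sum, Finset.mul_sum, Finset.sum_mul, ← Finset.sum_sub_distrib]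
    exact Finset.sum_congr rfl fun t _ => by ring
  rw [e]
  ring

/-- Every function computed by a network is computed by a network whose cost is its penalty. -/
theorem ReLUNet.exists_cost_eq_penalty (θ : ReLUNet) :
    ∃ θ' : ReLUNet, θ'.toFun = θ.toFun ∧ ENNReal.ofReal θ'.cost = penalty θ.toFun := by
  obtain ⟨T, c, a, b, h, -, -⟩ := θ.exists_kinkForm
  obtain ⟨θ', h1, h2⟩ := h.costLE
  refine ⟨θ', h1, le_antisymm ((ENNReal.ofReal_le_ofReal h2).trans h.le_penalty) ?_⟩
  rw [← h1]
  exact θ'.penalty_le_cost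

/-! ### Interpolation at finitely many nodes -/

section Nodes

variable {T : Finset ℝ} (hT : T.Nonempty)

open Classical in
/-- The least point of `T` above `t`, or the largest point of `T` if there is none. -/
def upNode (t : ℝ) : ℝ :=
  if h : (T.filter (t ≤ ·)).Nonempty then (T.filter (t ≤ ·)).min' h else T.max' hT

open Classical in
/-- The largest point of `T` below `t`, or the least point of `T` if there is none. -/
def downNode (t : ℝ) : ℝ :=
  if h : (T.filter (· ≤ t)).Nonempty then (T.filter (· ≤ t)).max' h else T.min' hT

theorem upNode_mem (t : ℝ) : upNode hT t ∈ T := by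
  unfold upNode
  split_ifs with h
  · exact (Finset.mem_filter.1 (Finset.min'_mem _ h)).1
  · exact Finset.max'_mem _ _

theorem downNode_mem (t : ℝ) : downNode hT t ∈ T := by
  unfold downNode
  split_ifs with h
  · exact (Finset.mem_filter.1 (Finset.max'_mem _ h)).1
  · exact Finset.min'_mem _ _

theorem upNode_le {a t : ℝ} (ha : a ∈ T) (h : t ≤ a) : upNode hT t ≤ a := by
  have hm : a ∈ T.filter (t ≤ ·) := Finset.mem_filter.2 ⟨ha, h⟩
  unfold upNode
  rw [dif_pos ⟨a, hm⟩]
  exact Finset.min'_le _ _ hm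

theorem le_upNode {a t : ℝ} (ha : a ∈ T) (h : t ≤ a) : t ≤ upNode hT t := by
  have hm : a ∈ T.filter (t ≤ ·) := Finset.mem_filter.2 ⟨ha, h⟩
  unfold upNode
  rw [dif_pos ⟨a, hm⟩]
  exact (Finset.mem_filter.1 (Finset.min'_mem _ ⟨a, hm⟩)).2

theorem le_downNode {a t : ℝ} (ha : a ∈ T) (h : a ≤ t) : a ≤ downNode hT t := by
  have hm : a ∈ T.filter (· ≤ t) := Finset.mem_filter.2 ⟨ha, h⟩
  unfold downNode
  rw [dif_pos ⟨a, hm⟩]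
  exact Finset.le_max' _ _ hm

theorem downNode_le {a t : ℝ} (ha : a ∈ T) (h : a ≤ t) : downNode hT t ≤ t := by
  have hm : a ∈ T.filter (· ≤ t) := Finset.mem_filter.2 ⟨ha, h⟩
  unfold downNode
  rw [dif_pos ⟨a, hm⟩]
  exact (Finset.mem_filter.1 (Finset.max'_mem _ ⟨a, hm⟩)).2

theorem upNode_eq_max {t : ℝ} (h : ∀ a ∈ T, a < t) : upNode hT t = T.max' hT := by
  unfold upNode
  rw [dif_neg]
  rintro ⟨a, ha⟩
  obtain ⟨h1, h2⟩ := Finset.mem_filter.1 ha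
  exact not_lt.2 h2 (h a h1)

theorem downNode_eq_min {t : ℝ} (h : ∀ a ∈ T, t < a) : downNode hT t = T.min' hT := by
  unfold downNode
  rw [dif_neg]
  rintro ⟨a, ha⟩
  obtain ⟨h1, h2⟩ := Finset.mem_filter.1 ha
  exact not_lt.2 h2 (h a h1)

theorem downNode_le_upNode (t : ℝ) : downNode hT t ≤ upNode hT t := by
  by_cases h1 : ∃ a ∈ T, a ≤ t
  · obtain ⟨a, ha, hat⟩ := h1
    by_cases h2 : ∃ b ∈ T, t ≤ b
    · obtain ⟨b, hb, htb⟩ := h2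
      exact (downNode_le hT ha hat).trans (le_upNode hT hb htb)
    · push Not at h2
      rw [upNode_eq_max hT h2]
      exact Finset.le_max' _ _ (downNode_mem hT t)
  · push Not at h1
    rw [downNode_eq_min hT h1]
    exact Finset.min'_le _ _ (upNode_mem hT t)

theorem monotone_upNode : Monotone (upNode hT) := by
  intro s t hst
  by_cases h : ∃ a ∈ T, t ≤ a
  · obtain ⟨a, ha, hta⟩ := h
    exact upNode_le hT (upNode_mem hT t) (hst.trans (le_upNode hT ha hta))
  · push Not at h
    rw [upNode_eq_max hT h]
    exact Finset.le_max' _ _ (upNode_mem hT s)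

theorem monotone_downNode : Monotone (downNode hT) := by
  intro s t hst
  by_cases h : ∃ a ∈ T, a ≤ s
  · obtain ⟨a, ha, hta⟩ := h
    exact le_downNode hT (downNode_mem hT s) ((downNode_le hT ha hta).trans hst)
  · push Not at h
    rw [downNode_eq_min hT h]
    exact Finset.min'_le _ _ (downNode_mem hT t)

/-- The nearest point to `t` in the convex hull of `T`. -/
def nodeProj (t : ℝ) : ℝ := max (downNode hT t) (min (upNode hT t) t)

/-- The barycentric coordinate of `nodeProj hT t` between the neighbouring nodes. -/
def nodeWeight (t : ℝ) : ℝ :=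
  (nodeProj hT t - downNode hT t) / (upNode hT t - downNode hT t)

theorem nodeProj_mem (t : ℝ) : nodeProj hT t ∈ Set.Icc (downNode hT t) (upNode hT t) :=
  ⟨le_max_left _ _, max_le (downNode_le_upNode hT t) (min_le_left _ _)⟩

theorem nodeWeight_mem (t : ℝ) : nodeWeight hT t ∈ Set.Icc (0 : ℝ) 1 := by
  obtain ⟨h1, h2⟩ := nodeProj_mem hT t
  exact ⟨div_nonneg (by linarith) (by linarith), div_le_one_of_le₀ (by linarith) (by linarith)⟩

theorem nodeProj_eq (t : ℝ) :
    nodeProj hT t = (1 - nodeWeight hT t) * downNode hT t + nodeWeight hT t * upNode hT t := by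
  obtain ⟨h1, h2⟩ := nodeProj_mem hT t
  have h3 : nodeWeight hT t * (upNode hT t - downNode hT t) =
      nodeProj hT t - downNode hT t := by
    unfold nodeWeight
    rcases (downNode_le_upNode hT t).eq_or_lt with h | h
    · have : nodeProj hT t = downNode hT t := le_antisymm (by rw [h]; exact h2) h1
      rw [this, h]
      simp
    · rw [div_mul_cancel₀ _ (by linarith)]
  linarith

theorem measurable_upNode : Measurable (upNode hT) := (monotone_upNode hT).measurable

theorem measurable_downNode : Measurable (downNode hT) := (monotone_downNode hT).measurable

theorem measurable_nodeProj : Measurable (nodeProj hT) :=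
  (measurable_downNode hT).max ((measurable_upNode hT).min measurable_id)

theorem measurable_nodeWeight : Measurable (nodeWeight hT) :=
  ((measurable_nodeProj hT).sub (measurable_downNode hT)).div
    ((measurable_upNode hT).sub (measurable_downNode hT))

theorem abs_nodeProj_le (t : ℝ) : |nodeProj hT t| ≤ ∑ s ∈ T, |s| := by
  obtain ⟨h1, h2⟩ := nodeProj_mem hT t
  have hd := Finset.single_le_sum (fun s _ => abs_nonneg s) (downNode_mem hT t)
  have hu := Finset.single_le_sum (fun s _ => abs_nonneg s) (upNode_mem hT t)
  rw [abs_le]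
  constructor
  · linarith [neg_abs_le (downNode hT t)]
  · linarith [le_abs_self (upNode hT t)]

/-- The error at `x` of the interpolation of `|x - t|` at the nodes. -/
def nodeDefect (x t : ℝ) : ℝ :=
  (1 - nodeWeight hT t) * |x - downNode hT t| + nodeWeight hT t * |x - upNode hT t| +
    |t - nodeProj hT t| - |x - t|

theorem nodeDefect_eq_zero_of_le {a x t : ℝ} (ha : a ∈ T) (h1 : t ≤ a) (h2 : a ≤ x) :
    nodeDefect hT x t = 0 := by
  have hu := upNode_le hT ha h1
  have hd := downNode_le_upNode hT t
  have hp : t ≤ nodeProj hT t := le_max_of_le_right (le_min (le_upNode hT ha h1) le_rfl)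
  have e := nodeProj_eq hT t
  unfold nodeDefect
  rw [abs_of_nonneg (by linarith), abs_of_nonneg (by linarith), abs_of_nonpos (by linarith),
    abs_of_nonneg (by linarith)]
  linarith

theorem nodeDefect_eq_zero_of_ge {a x t : ℝ} (ha : a ∈ T) (h1 : a ≤ t) (h2 : x ≤ a) :
    nodeDefect hT x t = 0 := by
  have hu := le_downNode hT ha h1
  have hd := downNode_le_upNode hT t
  have hp : nodeProj hT t ≤ t := max_le (downNode_le hT ha h1) (min_le_right _ _)
  have e := nodeProj_eq hT t
  unfold nodeDefect
  rw [abs_of_nonpos (by linarith), abs_of_nonpos (by linarith), abs_of_nonneg (by linarith),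
    abs_of_nonpos (by linarith)]
  linarith

theorem nodeDefect_eq_zero_of_mem {x : ℝ} (hx : x ∈ T) (t : ℝ) : nodeDefect hT x t = 0 := by
  rcases le_total t x with h | h
  · exact nodeDefect_eq_zero_of_le hT hx h le_rfl
  · exact nodeDefect_eq_zero_of_ge hT hx h le_rfl

theorem abs_nodeDefect_sub_le (x y t : ℝ) :
    |nodeDefect hT x t - nodeDefect hT y t| ≤ 2 * |x - y| := by
  obtain ⟨h0, h1⟩ := nodeWeight_mem hT t
  have key : ∀ s : ℝ, |(|x - s| - |y - s|)| ≤ |x - y| := fun s => by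
    simpa using abs_abs_sub_abs_le_abs_sub (x - s) (y - s)
  have k1 := abs_le.1 (key (downNode hT t))
  have k2 := abs_le.1 (key (upNode hT t))
  have k3 := abs_le.1 (key t)
  unfold nodeDefect
  rw [abs_le]
  constructor
  · nlinarith [mul_nonneg h0 (sub_nonneg.2 k2.1), mul_nonneg (sub_nonneg.2 h1) (sub_nonneg.2 k1.1)]
  · nlinarith [mul_nonneg h0 (sub_nonneg.2 k2.2), mul_nonneg (sub_nonneg.2 h1) (sub_nonneg.2 k1.2)]

open Classical in
/-- The hat functions of the nodes. -/
def nodeHat (s t : ℝ) : ℝ :=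
  (if s = downNode hT t then 1 - nodeWeight hT t else 0) +
    (if s = upNode hT t then nodeWeight hT t else 0)

theorem nodeHat_nonneg (s t : ℝ) : 0 ≤ nodeHat hT s t := by
  obtain ⟨h0, h1⟩ := nodeWeight_mem hT t
  unfold nodeHat
  split_ifs <;> linarith

theorem sum_nodeHat_mul (F : ℝ → ℝ) (t : ℝ) :
    ∑ s ∈ T, nodeHat hT s t * F s =
      (1 - nodeWeight hT t) * F (downNode hT t) + nodeWeight hT t * F (upNode hT t) := by
  simp [nodeHat, add_mul, Finset.sum_add_distrib, upNode_mem, downNode_mem]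

theorem sum_nodeHat (t : ℝ) : ∑ s ∈ T, nodeHat hT s t = 1 := by
  simpa using sum_nodeHat_mul hT (fun _ => 1) t

theorem integrable_nodeHat (P : Measure ℝ) [IsFiniteMeasure P] (s : ℝ) :
    Integrable (nodeHat hT s) P := by
  refine Integrable.of_bound (C := 2) ?_ (ae_of_all _ fun t => ?_)
  · refine Measurable.aestronglyMeasurable (Measurable.add (Measurable.ite ?_ ?_ ?_)
      (Measurable.ite ?_ ?_ ?_))
    · exact measurableSet_eq_fun measurable_const (measurable_downNode hT)
    · exact measurable_const.sub (measurable_nodeWeight hT)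
    · exact measurable_const
    · exact measurableSet_eq_fun measurable_const (measurable_upNode hT)
    · exact measurable_nodeWeight hT
    · exact measurable_const
  · rw [Real.norm_eq_abs, abs_of_nonneg (nodeHat_nonneg hT s t)]
    obtain ⟨h0, h1⟩ := nodeWeight_mem hT t
    unfold nodeHat
    split_ifs <;> linarith

theorem integrable_abs_sub_nodeProj (P : Measure ℝ) [IsFiniteMeasure P] :
    Integrable (fun t => |t - nodeProj hT t| - |t|) P := by
  refine Integrable.of_bound (C := ∑ s ∈ T, |s|) ?_ (ae_of_all _ fun t => ?_)
  · have := measurable_nodeProj hT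
    exact Measurable.aestronglyMeasurable (by fun_prop)
  · rw [Real.norm_eq_abs]
    refine (abs_abs_sub_abs_le_abs_sub _ _).trans ?_
    simpa using abs_nodeProj_le hT t

theorem nodeDefect_eq (x t : ℝ) :
    nodeDefect hT x t = ∑ s ∈ T, nodeHat hT s t * |x - s| +
      (|t - nodeProj hT t| - |t|) - greenKernel x t := by
  rw [sum_nodeHat_mul hT fun s => |x - s|]
  simp only [nodeDefect, greenKernel]
  ring

theorem integrable_nodeDefect (P : Measure ℝ) [IsFiniteMeasure P] (x : ℝ) :
    Integrable (nodeDefect hT x) P := by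
  rw [funext (nodeDefect_eq hT x)]
  exact ((integrable_finsetSum _ fun s _ => (integrable_nodeHat hT P s).mul_const _).add
    (integrable_abs_sub_nodeProj hT P)).sub (integrable_greenKernel P x)

theorem integral_nodeDefect (P : Measure ℝ) [IsFiniteMeasure P] (x : ℝ) :
    ∫ t, nodeDefect hT x t ∂P = ∑ s ∈ T, (∫ t, nodeHat hT s t ∂P) * |x - s| +
      ∫ t, (|t - nodeProj hT t| - |t|) ∂P - ∫ t, greenKernel x t ∂P := by
  have i1 : ∀ s ∈ T, Integrable (fun t => nodeHat hT s t * |x - s|) P :=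
    fun s _ => (integrable_nodeHat hT P s).mul_const _
  have i2 : Integrable (fun t => ∑ s ∈ T, nodeHat hT s t * |x - s| +
      (|t - nodeProj hT t| - |t|)) P :=
    (integrable_finsetSum _ i1).add (integrable_abs_sub_nodeProj hT P)
  simp_rw [nodeDefect_eq hT x]
  rw [integral_sub i2 (integrable_greenKernel P x), integral_add (integrable_finsetSum _ i1)
    (integrable_abs_sub_nodeProj hT P), integral_finsetSum _ i1]
  simp_rw [integral_mul_const]

theorem sum_integral_nodeHat (P : Measure ℝ) [IsFiniteMeasure P] :
    ∑ s ∈ T, ∫ t, nodeHat hT s t ∂P = P.real Set.univ := by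
  rw [← integral_finsetSum _ fun s _ => integrable_nodeHat hT P s]
  simp_rw [sum_nodeHat hT]
  simp

/-- The set of points that no node separates from `z`. -/
def nodeCell (T : Finset ℝ) (z : ℝ) : Set ℝ := {t | ∀ a ∈ T, a ∉ Set.uIcc t z}

theorem measurableSet_nodeCell (T : Finset ℝ) (z : ℝ) : MeasurableSet (nodeCell T z) := by
  have e : nodeCell T z = ⋂ a ∈ T, {t | a ∈ Set.uIcc t z}ᶜ := by
    ext t
    simp [nodeCell]
  rw [e]
  refine Finset.measurableSet_biInter _ fun a _ => MeasurableSet.compl ?_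
  simp only [Set.mem_uIcc]
  measurability

theorem abs_integral_nodeDefect_sub_le (P : Measure ℝ) [IsFiniteMeasure P] {x y : ℝ} (hxy : x < y)
    (h : ∀ a ∈ T, a ∉ Set.Ioo x y) :
    |∫ t, nodeDefect hT x t ∂P - ∫ t, nodeDefect hT y t ∂P| ≤
      2 * P.real (nodeCell T ((x + y) / 2)) * |x - y| := by
  rw [← integral_sub (integrable_nodeDefect hT P x) (integrable_nodeDefect hT P y)]
  have b : ∀ t, ‖nodeDefect hT x t - nodeDefect hT y t‖ ≤
      (nodeCell T ((x + y) / 2)).indicator (fun _ => 2 * |x - y|) t := by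
    intro t
    by_cases ht : t ∈ nodeCell T ((x + y) / 2)
    · rw [Set.indicator_of_mem ht]
      exact abs_nodeDefect_sub_le hT x y t
    · rw [Set.indicator_of_notMem ht]
      simp only [nodeCell, Set.mem_ofPred_eq, not_forall, not_not] at ht
      obtain ⟨a, ha, hm⟩ := ht
      have hn := h a ha
      rw [Set.mem_Ioo, not_and, not_lt] at hn
      rw [Set.mem_uIcc] at hm
      rcases hm with ⟨h1, h2⟩ | ⟨h1, h2⟩
      · have hax : a ≤ x := by
          by_contra hc
          linarith [hn (not_le.1 hc)]
        rw [nodeDefect_eq_zero_of_le hT ha h1 hax,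
          nodeDefect_eq_zero_of_le hT ha h1 (hax.trans hxy.le)]
        simp
      · have hya : y ≤ a := hn (by linarith)
        rw [nodeDefect_eq_zero_of_ge hT ha h2 (hxy.le.trans hya),
          nodeDefect_eq_zero_of_ge hT ha h2 hya]
        simp
  have hm := measurableSet_nodeCell T ((x + y) / 2)
  refine (norm_integral_le_of_norm_le ((integrable_const _).indicator hm)
    (ae_of_all _ b)).trans ?_
  rw [integral_indicator hm, setIntegral_const, smul_eq_mul]
  exact le_of_eq (by ring)

end Nodes

/-- A function that vanishes on a finite set and is `δ`-Lipschitz on the intervals without points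
of that set is `δ`-Lipschitz. -/
theorem lipschitz_of_nodes {e : ℝ → ℝ} {T : Finset ℝ} {δ : ℝ} (h0 : ∀ x ∈ T, e x = 0)
    (h : ∀ x y, x < y → (∀ a ∈ T, a ∉ Set.Ioo x y) → |e x - e y| ≤ δ * |x - y|) (x y : ℝ) :
    |e x - e y| ≤ δ * |x - y| := by
  classical
  wlog hxy : x < y generalizing x y
  · rcases (not_lt.1 hxy).eq_or_lt with rfl | hlt
    · simp
    · rw [abs_sub_comm, abs_sub_comm x y]
      exact this y x hlt
  by_cases hn : (T.filter (· ∈ Set.Ioo x y)).Nonempty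
  · set p := (T.filter (· ∈ Set.Ioo x y)).min' hn with hp
    set q := (T.filter (· ∈ Set.Ioo x y)).max' hn with hq
    obtain ⟨pT, px⟩ := Finset.mem_filter.1 (Finset.min'_mem _ hn)
    obtain ⟨qT, qx⟩ := Finset.mem_filter.1 (Finset.max'_mem _ hn)
    have hpq : p ≤ q := Finset.min'_le _ _ (Finset.max'_mem _ hn)
    rw [← hp] at pT px
    rw [← hq] at qT qx
    have h1 := h x p px.1 fun a ha hm => not_lt.2
      (Finset.min'_le _ a (Finset.mem_filter.2 ⟨ha, hm.1, hm.2.trans px.2⟩)) (hp ▸ hm.2)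
    have h2 := h q y qx.2 fun a ha hm => not_lt.2
      (Finset.le_max' _ a (Finset.mem_filter.2 ⟨ha, qx.1.trans hm.1, hm.2⟩)) (hq ▸ hm.1)
    rw [h0 p pT, abs_of_neg (by linarith [px.1] : x - p < 0)] at h1
    rw [h0 q qT, abs_of_neg (by linarith [qx.2] : q - y < 0)] at h2
    rw [abs_of_neg (by linarith : x - y < 0)]
    have hδ : 0 ≤ δ := by
      by_contra hc
      have := abs_nonneg (e x - 0)
      nlinarith [px.1]
    rw [sub_zero] at h1
    rw [zero_sub, abs_neg] at h2
    have := abs_sub (e x) (e y)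
    nlinarith
  · refine h x y hxy fun a ha hm => hn ⟨a, Finset.mem_filter.2 ⟨ha, hm⟩⟩

/-- Interpolation at finitely many nodes, with the asymptotic slopes kept, increases neither the
total variation of the derivative nor the sum of the asymptotic slopes. -/
theorem GreenRepr.exists_interpolation {f : ℝ → ℝ} {a b : ℝ} {P N : Measure ℝ} [IsFiniteMeasure P]
    [IsFiniteMeasure N] (hf : GreenRepr f a b P N) {T : Finset ℝ} (hT : T.Nonempty) :
    ∃ (g : ℝ → ℝ) (c : ℝ → ℝ) (b' : ℝ), KinkForm g T c a b' ∧
      ∑ t ∈ T, |c t| ≤ (P + N).real Set.univ ∧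
      ∑ t ∈ T, c t = P.real Set.univ - N.real Set.univ ∧ (∀ x ∈ T, g x = f x) ∧
      ∀ δ, (∀ z, (P + N).real (nodeCell T z) ≤ δ) →
        ∀ x y, |(g x - f x) - (g y - f y)| ≤ δ * |x - y| := by
  set c : ℝ → ℝ := fun s => ∫ t, nodeHat hT s t ∂P - ∫ t, nodeHat hT s t ∂N with hc
  set b' := b + (∫ t, (|t - nodeProj hT t| - |t|) ∂P - ∫ t, (|t - nodeProj hT t| - |t|) ∂N) / 2
    with hb'
  set g : ℝ → ℝ := fun x => a * x + b' + (∑ t ∈ T, c t * |x - t|) / 2 with hg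
  have he : ∀ x, g x - f x = (∫ t, nodeDefect hT x t ∂P - ∫ t, nodeDefect hT x t ∂N) / 2 := by
    intro x
    rw [integral_nodeDefect, integral_nodeDefect, hf x]
    simp only [hg, hc, hb', sub_mul, Finset.sum_sub_distrib]
    ring
  have h0 : ∀ x ∈ T, g x - f x = 0 := fun x hx => by
    rw [he x]
    simp [nodeDefect_eq_zero_of_mem hT hx]
  refine ⟨g, c, b', fun x => rfl, ?_, ?_, fun x hx => sub_eq_zero.1 (h0 x hx), fun δ hδ => ?_⟩
  · rw [measureReal_add_apply, ← sum_integral_nodeHat hT P, ← sum_integral_nodeHat hT N,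
      ← Finset.sum_add_distrib]
    refine Finset.sum_le_sum fun s _ => (abs_sub _ _).trans (le_of_eq ?_)
    rw [abs_of_nonneg (integral_nonneg (nodeHat_nonneg hT s)),
      abs_of_nonneg (integral_nonneg (nodeHat_nonneg hT s))]
  · rw [Finset.sum_sub_distrib, sum_integral_nodeHat, sum_integral_nodeHat]
  · refine lipschitz_of_nodes h0 fun x y hxy hn => ?_
    have hP := abs_integral_nodeDefect_sub_le hT P hxy hn
    have hN := abs_integral_nodeDefect_sub_le hT N hxy hn
    have hz := hδ ((x + y) / 2)
    rw [measureReal_add_apply] at hz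
    have e : (g x - f x) - (g y - f y) =
        (∫ t, nodeDefect hT x t ∂P - ∫ t, nodeDefect hT y t ∂P) / 2 -
        (∫ t, nodeDefect hT x t ∂N - ∫ t, nodeDefect hT y t ∂N) / 2 := by
      rw [he x, he y]
      ring
    rw [e]
    refine (abs_sub _ _).trans ?_
    rw [abs_div, abs_div, abs_two]
    nlinarith [abs_nonneg (x - y)]

/-! ### Fine sets of nodes -/

theorem nodeCell_anti {S T : Finset ℝ} (h : S ⊆ T) (z : ℝ) : nodeCell T z ⊆ nodeCell S z :=
  fun _ ht a ha => ht a (h ha)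

theorem exists_radius_measureReal_le (ν : Measure ℝ) [IsFiniteMeasure ν] {δ : ℝ} (hδ : 0 < δ)
    (z : ℝ) : ∃ r > 0, ν.real (Set.Ioo (z - r) (z + r) \ {z}) ≤ δ := by
  set s : ℕ → Set ℝ := fun n => Set.Ioo (z - 1 / ((n : ℝ) + 1)) (z + 1 / ((n : ℝ) + 1)) \ {z}
  have hanti : Antitone s := by
    intro m n hmn
    have := one_div_le_one_div_of_le (by positivity : (0 : ℝ) < m + 1)
      (by exact_mod_cast Nat.add_le_add_right hmn 1 : (m : ℝ) + 1 ≤ n + 1)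
    exact Set.sdiff_subset_sdiff_left (Set.Ioo_subset_Ioo (by linarith) (by linarith))
  have h := tendsto_measure_iInter_atTop (μ := ν) (s := s)
    (fun _ => (measurableSet_Ioo.diff (measurableSet_singleton z)).nullMeasurableSet) hanti
    ⟨0, measure_ne_top _ _⟩
  have e : ⋂ n, s n = ∅ := by
    refine Set.eq_empty_of_forall_notMem fun x hx => ?_
    rw [Set.mem_iInter] at hx
    have hne : 0 < |x - z| := abs_pos.2 (sub_ne_zero.2 (hx 0).2)
    obtain ⟨n, hn⟩ := exists_nat_one_div_lt hne
    have := (hx n).1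
    have h2 : |x - z| < 1 / ((n : ℝ) + 1) := by
      rw [abs_lt]
      constructor <;> linarith [this.1, this.2]
    linarith
  rw [e, measure_empty] at h
  have h' : Tendsto (fun n => ν.real (s n)) atTop (nhds 0) :=
    (ENNReal.tendsto_toReal ENNReal.zero_ne_top).comp h
  obtain ⟨n, hn⟩ := (h'.eventually (gt_mem_nhds hδ)).exists
  exact ⟨1 / ((n : ℝ) + 1), by positivity, hn.le⟩

theorem exists_fine_nodes (ν : Measure ℝ) [IsFiniteMeasure ν] {δ : ℝ} (hδ : 0 < δ) :
    ∃ T : Finset ℝ, ∀ z, ν.real (nodeCell T z) ≤ δ := by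
  classical
  obtain ⟨M, hM⟩ := ((tendsto_measureReal_Ioi ν).eventually (gt_mem_nhds hδ)).exists
  obtain ⟨m, hm⟩ := ((tendsto_measureReal_Iio ν).eventually (gt_mem_nhds hδ)).exists
  choose r hr hν using exists_radius_measureReal_le ν hδ
  obtain ⟨S, -, hS⟩ := (isCompact_Icc (a := m) (b := M)).elim_nhds_subcover
    (fun z => Set.Ioo (z - r z) (z + r z))
    (fun z _ => Ioo_mem_nhds (by linarith [hr z]) (by linarith [hr z]))
  refine ⟨{m, M} ∪ S.biUnion fun z => {z - r z, z, z + r z}, fun z => ?_⟩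
  rcases lt_or_ge M z with h1 | h1
  · refine le_trans (measureReal_mono fun t ht => ?_) hM.le
    by_contra hc
    exact ht M (by simp) (Set.mem_uIcc_of_le (not_lt.1 hc) h1.le)
  rcases lt_or_ge z m with h2 | h2
  · refine le_trans (measureReal_mono fun t ht => ?_) hm.le
    by_contra hc
    exact ht m (by simp) (Set.mem_uIcc_of_ge h2.le (not_lt.1 hc))
  obtain ⟨p, hp, hz⟩ := Set.mem_iUnion₂.1 (hS ⟨h2, h1⟩)
  refine le_trans (measureReal_mono fun t ht => ?_) (hν p)
  have hmem : ∀ q, q = p - r p ∨ q = p ∨ q = p + r p →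
      q ∈ ({m, M} ∪ S.biUnion fun z => {z - r z, z, z + r z} : Finset ℝ) := by
    intro q hq
    refine Finset.mem_union_right _ (Finset.mem_biUnion.2 ⟨p, hp, ?_⟩)
    simpa using hq
  refine ⟨⟨?_, ?_⟩, ?_⟩
  · by_contra hc
    exact ht _ (hmem _ (Or.inl rfl)) (Set.mem_uIcc_of_le (not_lt.1 hc) hz.1.le)
  · by_contra hc
    exact ht _ (hmem _ (Or.inr (Or.inr rfl))) (Set.mem_uIcc_of_ge hz.2.le (not_lt.1 hc))
  · intro hc
    rw [Set.mem_singleton_iff] at hc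
    exact ht _ (hmem _ (Or.inr (Or.inl rfl))) (hc ▸ Set.left_mem_uIcc)

/-! ### Comparison of asymptotic slopes -/

theorem tendsto_integral_greenKernel_div_atTop (P : Measure ℝ) [IsFiniteMeasure P] :
    Tendsto (fun x => (∫ t, greenKernel x t ∂P) / x) atTop (nhds (P.real Set.univ)) := by
  have h := tendsto_integral_filter_of_dominated_convergence (μ := P) (l := atTop)
    (F := fun x t => greenKernel x t / x) (f := fun _ => (1 : ℝ)) (fun _ => 1)
    (Eventually.of_forall fun x => ((integrable_greenKernel P x).div_const x).aestronglyMeasurable)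
    (Eventually.of_forall fun x => ae_of_all _ fun t => by
      rw [Real.norm_eq_abs, abs_div]
      exact div_le_one_of_le₀ (abs_greenKernel_le x t) (abs_nonneg x))
    (integrable_const _)
    (ae_of_all _ fun t => by
      have h0 : Tendsto (fun x : ℝ => 1 - (t + |t|) * x⁻¹) atTop (nhds 1) := by
        simpa using (tendsto_inv_atTop_zero.const_mul (t + |t|)).const_sub (1 : ℝ)
      refine h0.congr' ?_
      filter_upwards [eventually_ge_atTop t, eventually_gt_atTop 0] with x hx hx0
      unfold greenKernel
      rw [abs_of_nonneg (sub_nonneg.2 hx)]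
      field_simp
      ring)
  simpa [integral_div] using h

theorem tendsto_integral_greenKernel_div_atBot (P : Measure ℝ) [IsFiniteMeasure P] :
    Tendsto (fun x => (∫ t, greenKernel x t ∂P) / x) atBot (nhds (-P.real Set.univ)) := by
  have h := tendsto_integral_filter_of_dominated_convergence (μ := P) (l := atBot)
    (F := fun x t => greenKernel x t / x) (f := fun _ => (-1 : ℝ)) (fun _ => 1)
    (Eventually.of_forall fun x => ((integrable_greenKernel P x).div_const x).aestronglyMeasurable)
    (Eventually.of_forall fun x => ae_of_all _ fun t => by
      rw [Real.norm_eq_abs, abs_div]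
      exact div_le_one_of_le₀ (abs_greenKernel_le x t) (abs_nonneg x))
    (integrable_const _)
    (ae_of_all _ fun t => by
      have h0 : Tendsto (fun x : ℝ => (t - |t|) * x⁻¹ - 1) atBot (nhds (-1)) := by
        simpa using (tendsto_inv_atBot_zero.const_mul (t - |t|)).sub_const (1 : ℝ)
      refine h0.congr' ?_
      filter_upwards [eventually_le_atBot t, eventually_lt_atBot 0] with x hx hx0
      unfold greenKernel
      rw [abs_of_nonpos (sub_nonpos.2 hx)]
      have := hx0.ne
      field_simp
      ring)
  simpa [integral_div] using h

section Slopes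

variable {f : ℝ → ℝ} {a b : ℝ} {P N : Measure ℝ} [IsFiniteMeasure P] [IsFiniteMeasure N]

theorem GreenRepr.tendsto_div_atTop (hf : GreenRepr f a b P N) :
    Tendsto (fun x => f x / x) atTop
      (nhds (a + (P.real Set.univ - N.real Set.univ) / 2)) := by
  have h := ((tendsto_inv_atTop_zero.const_mul b).const_add a).add
    (((tendsto_integral_greenKernel_div_atTop P).sub
      (tendsto_integral_greenKernel_div_atTop N)).div_const 2)
  rw [mul_zero, add_zero] at h
  refine h.congr' ?_
  filter_upwards [eventually_ne_atTop 0] with x hx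
  rw [hf x]
  field_simp

theorem GreenRepr.tendsto_div_atBot (hf : GreenRepr f a b P N) :
    Tendsto (fun x => f x / x) atBot
      (nhds (a - (P.real Set.univ - N.real Set.univ) / 2)) := by
  have h := ((tendsto_inv_atBot_zero.const_mul b).const_add a).add
    (((tendsto_integral_greenKernel_div_atBot P).sub
      (tendsto_integral_greenKernel_div_atBot N)).div_const 2)
  rw [mul_zero, add_zero] at h
  have e : a + (-P.real Set.univ - -N.real Set.univ) / 2 =
      a - (P.real Set.univ - N.real Set.univ) / 2 := by ring
  rw [e] at h
  refine h.congr' ?_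
  filter_upwards [eventually_ne_atBot 0] with x hx
  rw [hf x]
  field_simp

end Slopes

theorem abs_slope_sub_le {l : Filter ℝ} [l.NeBot] (hl : Tendsto (fun x : ℝ => |x|) l atTop)
    {f g : ℝ → ℝ} {A B ε : ℝ} (hf : Tendsto (fun x => f x / x) l (nhds A))
    (hg : Tendsto (fun x => g x / x) l (nhds B))
    (h : ∀ᶠ x in l, |f x - g x| ≤ ε * (1 + |x|)) : |A - B| ≤ ε := by
  have h1 : Tendsto (fun x : ℝ => ε * (|x|⁻¹ + 1)) l (nhds ε) := by
    simpa using (((tendsto_inv_atTop_zero.comp hl).add_const 1).const_mul ε)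
  refine le_of_tendsto_of_tendsto (hf.sub hg).abs h1 ?_
  filter_upwards [h, hl.eventually_gt_atTop 0] with x hx hx0
  rw [← sub_div, abs_div, div_le_iff₀ hx0]
  refine hx.trans (le_of_eq ?_)
  field_simp

/-! ### Vague compactness -/

theorem exists_tendsto_ultrafilter (U : Ultrafilter ℕ) {x : ℕ → ℝ} {C : ℝ}
    (h : ∀ n, |x n| ≤ C) : ∃ l, Tendsto x U (nhds l) := by
  obtain ⟨l, -, hl⟩ := isCompact_iff_ultrafilter_le_nhds.1 (isCompact_Icc (a := -C) (b := C))
    (U.map x) (by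
      rw [le_principal_iff]
      exact mem_map.2 (Eventually.of_forall fun n => abs_le.1 (h n)))
  exact ⟨l, hl⟩

open CompactlySupported in
/-- Bounded sequences of finite measures converge vaguely along an ultrafilter. -/
theorem exists_vague_limit (U : Ultrafilter ℕ) (Q : ℕ → Measure ℝ) [∀ n, IsFiniteMeasure (Q n)]
    {C m : ℝ} (hC : ∀ n, (Q n).real Set.univ ≤ C)
    (hm : Tendsto (fun n => (Q n).real Set.univ) U (nhds m)) :
    ∃ Q' : Measure ℝ, Q' Set.univ ≤ ENNReal.ofReal m ∧
      ∀ φ : ℝ → ℝ, Continuous φ → HasCompactSupport φ →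
        Tendsto (fun n => ∫ x, φ x ∂Q n) U (nhds (∫ x, φ x ∂Q')) := by
  have hint : ∀ (φ : C_c(ℝ, ℝ)) (n : ℕ), Integrable φ (Q n) := fun φ n =>
    φ.continuous.integrable_of_hasCompactSupport φ.hasCompactSupport
  have hex : ∀ φ : C_c(ℝ, ℝ), ∃ l, Tendsto (fun n => ∫ x, φ x ∂Q n) U (nhds l) := by
    intro φ
    obtain ⟨K, hK⟩ := φ.continuous.bounded_above_of_compact_support φ.hasCompactSupport
    refine exists_tendsto_ultrafilter U (C := K * C) fun n => ?_
    have hK0 : 0 ≤ K := (norm_nonneg _).trans (hK 0)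
    exact (norm_integral_le_of_norm_le_const (μ := Q n) (ae_of_all _ hK)).trans
      (mul_le_mul_of_nonneg_left (hC n) hK0)
  choose l hl using hex
  let Λ : C_c(ℝ, ℝ) →ₗ[ℝ] ℝ :=
    { toFun := l
      map_add' := fun φ ψ => tendsto_nhds_unique (hl (φ + ψ)) (by
        refine ((hl φ).add (hl ψ)).congr fun n => ?_
        exact (integral_add (hint φ n) (hint ψ n)).symm)
      map_smul' := fun r φ => tendsto_nhds_unique (hl (r • φ)) (by
        refine ((hl φ).const_mul r).congr fun n => ?_
        exact (integral_const_mul r _).symm) }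
  let Λp : C_c(ℝ, ℝ) →ₚ[ℝ] ℝ := PositiveLinearMap.mk₀ Λ fun φ hφ =>
    ge_of_tendsto (hl φ) (Eventually.of_forall fun n => integral_nonneg hφ)
  refine ⟨RealRMK.rieszMeasure Λp, ?_, fun φ hφ hc => ?_⟩
  · rw [isOpen_univ.measure_eq_iSup_isCompact]
    refine iSup₂_le fun K _ => iSup_le fun hK => ?_
    obtain ⟨u, hu1, -, huc, hu⟩ :=
      exists_continuous_one_zero_of_isCompact hK isClosed_empty (Set.disjoint_empty K)
    let v : C_c(ℝ, ℝ) := ⟨u, huc⟩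
    refine (RealRMK.rieszMeasure_le_of_eq_one Λp (f := v) (fun x => (hu x).1) hK
      fun x hx => hu1 hx).trans (ENNReal.ofReal_le_ofReal ?_)
    refine le_of_tendsto_of_tendsto (hl v) hm (Eventually.of_forall fun n => ?_)
    refine (integral_mono (hint v n) (integrable_const 1) fun x => (hu x).2).trans ?_
    simp
  · have := RealRMK.integral_rieszMeasure Λp ⟨⟨φ, hφ⟩, hc⟩
    have h2 := hl ⟨⟨φ, hφ⟩, hc⟩
    exact this ▸ h2

/-! ### Lower semicontinuity of the penalty -/

theorem continuous_of_tendsto_weighted {h : ℕ → ℝ → ℝ} {f : ℝ → ℝ} (hc : ∀ n, Continuous (h n))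
    (hh : ∀ n x, |h n x - f x| ≤ 1 / ((n : ℝ) + 1) * (1 + |x|)) : Continuous f := by
  have hpos : ∀ x : ℝ, 0 < 1 + |x| := fun x => by positivity
  have hw : Continuous fun x : ℝ => 1 + |x| := by fun_prop
  have hu : TendstoUniformly (fun n x => h n x / (1 + |x|)) (fun x => f x / (1 + |x|)) atTop := by
    rw [Metric.tendstoUniformly_iff]
    intro ε hε
    filter_upwards [tendsto_one_div_add_atTop_nhds_zero_nat.eventually (gt_mem_nhds hε)] with n hn x
    rw [dist_comm, Real.dist_eq, ← sub_div, abs_div, abs_of_pos (hpos x)]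
    exact ((div_le_iff₀ (hpos x)).2 (hh n x)).trans_lt hn
  have hcont := hu.continuous (Eventually.of_forall fun n =>
    (hc n).div hw fun x => (hpos x).ne').frequently
  have e : f = fun x => f x / (1 + |x|) * (1 + |x|) := by
    funext x
    rw [div_mul_cancel₀ _ (hpos x).ne']
  rw [e]
  exact hcont.mul hw

theorem tendsto_integral_of_tendsto_weighted {h : ℕ → ℝ → ℝ} {f φ : ℝ → ℝ}
    (hc : ∀ n, Continuous (h n)) (hf : Continuous f)
    (hh : ∀ n x, |h n x - f x| ≤ 1 / ((n : ℝ) + 1) * (1 + |x|)) (hφ : ContDiff ℝ ∞ φ)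
    (hφc : HasCompactSupport φ) :
    Tendsto (fun n => ∫ x, h n x * iteratedDeriv 2 φ x) atTop
      (nhds (∫ x, f x * iteratedDeriv 2 φ x)) := by
  have i0 := (integrable_mul_iteratedDeriv_two hφ hφc (u := fun x => 1 + |x|) (by fun_prop)).norm
  have lim : Tendsto (fun n : ℕ => 1 / ((n : ℝ) + 1) *
      ∫ x, ‖(1 + |x|) * iteratedDeriv 2 φ x‖) atTop (nhds 0) := by
    simpa using tendsto_one_div_add_atTop_nhds_zero_nat.mul_const
      (∫ x, ‖(1 + |x|) * iteratedDeriv 2 φ x‖)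
  rw [tendsto_iff_norm_sub_tendsto_zero]
  refine squeeze_zero (fun _ => norm_nonneg _) (fun n => ?_) lim
  rw [← integral_sub (integrable_mul_iteratedDeriv_two hφ hφc (hc n))
    (integrable_mul_iteratedDeriv_two hφ hφc hf), ← integral_const_mul]
  refine norm_integral_le_of_norm_le (i0.const_mul _) (ae_of_all _ fun x => ?_)
  rw [← sub_mul, norm_mul, norm_mul, ← mul_assoc]
  refine mul_le_mul_of_nonneg_right ((hh n x).trans_eq ?_) (norm_nonneg _)
  rw [Real.norm_of_nonneg (by positivity : 0 ≤ 1 + |x|)]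

theorem penalty_le_of_approx {f : ℝ → ℝ} {C : ℝ}
    (h : ∀ ε > 0, ∃ θ : ReLUNet, (∀ x, |θ.toFun x - f x| ≤ ε * (1 + |x|)) ∧ θ.cost ≤ C) :
    penalty f ≤ ENNReal.ofReal C := by
  choose θ hθ hC using fun n : ℕ => h (1 / ((n : ℝ) + 1)) (by positivity)
  choose T c a b hk hsum ha using fun n => (θ n).exists_kinkForm
  set P : ℕ → Measure ℝ := fun n => pointMasses (T n) (c n)
  set N : ℕ → Measure ℝ := fun n => pointMasses (T n) (-c n)
  have hfin : ∀ n, IsFiniteMeasure (P n) := fun n => inferInstanceAs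
    (IsFiniteMeasure (pointMasses _ _))
  have hfinN : ∀ n, IsFiniteMeasure (N n) := fun n => inferInstanceAs
    (IsFiniteMeasure (pointMasses _ _))
  have hG : ∀ n, GreenRepr (θ n).toFun (a n) _ (P n) (N n) := fun n => (hk n).greenRepr
  have hmass : ∀ n, (P n).real Set.univ + (N n).real Set.univ ≤ C := fun n => by
    rw [measureReal_def, measureReal_def, ← ENNReal.toReal_add (measure_ne_top _ _)
      (measure_ne_top _ _), pointMasses_univ_add,
      ENNReal.toReal_ofReal (Finset.sum_nonneg fun _ _ => abs_nonneg _)]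
    exact (hsum n).trans (hC n)
  have bP : ∀ n, (P n).real Set.univ ≤ C := fun n => by
    linarith [hmass n, measureReal_nonneg (μ := N n) (s := Set.univ)]
  have bN : ∀ n, (N n).real Set.univ ≤ C := fun n => by
    linarith [hmass n, measureReal_nonneg (μ := P n) (s := Set.univ)]
  have hcont : ∀ n, Continuous (θ n).toFun := fun n => (hG n).weakSecondDeriv.1
  have hfc : Continuous f := continuous_of_tendsto_weighted hcont hθ
  let U : Ultrafilter ℕ := hyperfilter ℕ
  obtain ⟨mP, hmP⟩ := exists_tendsto_ultrafilter U (x := fun n => (P n).real Set.univ) (C := C)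
    fun n => by rw [abs_of_nonneg measureReal_nonneg]; exact bP n
  obtain ⟨mN, hmN⟩ := exists_tendsto_ultrafilter U (x := fun n => (N n).real Set.univ) (C := C)
    fun n => by rw [abs_of_nonneg measureReal_nonneg]; exact bN n
  obtain ⟨P', hP', hPlim⟩ := exists_vague_limit U P bP hmP
  obtain ⟨N', hN', hNlim⟩ := exists_vague_limit U N bN hmN
  have : IsFiniteMeasure P' := ⟨hP'.trans_lt ENNReal.ofReal_lt_top⟩
  have : IsFiniteMeasure N' := ⟨hN'.trans_lt ENNReal.ofReal_lt_top⟩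
  have hw : WeakSecondDeriv f P' N' := by
    refine ⟨hfc, fun φ hφ hφc => ?_⟩
    refine tendsto_nhds_unique ((tendsto_integral_of_tendsto_weighted hcont hfc hθ hφ hφc).mono_left
      Nat.hyperfilter_le_atTop) ?_
    refine ((hPlim φ hφ.continuous hφc).sub (hNlim φ hφ.continuous hφc)).congr fun n => ?_
    exact ((hG n).weakSecondDeriv.2 φ hφ hφc).symm
  have hm0 : 0 ≤ mP := ge_of_tendsto hmP (Eventually.of_forall fun _ => measureReal_nonneg)
  have hm1 : 0 ≤ mN := ge_of_tendsto hmN (Eventually.of_forall fun _ => measureReal_nonneg)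
  have hmC : mP + mN ≤ C := le_of_tendsto (hmP.add hmN) (Eventually.of_forall hmass)
  obtain ⟨a', b', hr⟩ := hw.exists_greenRepr
  refine max_le ?_ ?_
  · calc secondVariation f ≤ P' Set.univ + N' Set.univ := hw.secondVariation_le
      _ ≤ ENNReal.ofReal mP + ENNReal.ofReal mN := add_le_add hP' hN'
      _ = ENNReal.ofReal (mP + mN) := (ENNReal.ofReal_add hm0 hm1).symm
      _ ≤ _ := ENNReal.ofReal_le_ofReal hmC
  · refine ENNReal.ofReal_le_ofReal ?_
    rw [hr.derivLim_add, abs_mul, abs_two]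
    have key : ∀ n : ℕ, 2 * |a'| ≤ C + 2 * (1 / ((n : ℝ) + 1)) := fun n => by
      have h1 := abs_le.1 (abs_slope_sub_le tendsto_abs_atTop_atTop (hG n).tendsto_div_atTop
        hr.tendsto_div_atTop (Eventually.of_forall (hθ n)))
      have h2 := abs_le.1 (abs_slope_sub_le tendsto_abs_atBot_atTop (hG n).tendsto_div_atBot
        hr.tendsto_div_atBot (Eventually.of_forall (hθ n)))
      have h3 : 2 * |a n| ≤ C := (ha n).trans (hC n)
      have h4 : |a'| ≤ |a n| + 1 / ((n : ℝ) + 1) := by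
        have : |a' - a n| ≤ 1 / ((n : ℝ) + 1) := by
          rw [abs_le]
          constructor <;> linarith [h1.1, h1.2, h2.1, h2.2]
        linarith [abs_sub_abs_le_abs_sub a' (a n)]
      linarith
    have lim : Tendsto (fun n : ℕ => C + 2 * (1 / ((n : ℝ) + 1))) atTop (nhds C) := by
      simpa using (tendsto_one_div_add_atTop_nhds_zero_nat.const_mul (2 : ℝ)).const_add C
    exact ge_of_tendsto' lim key

theorem penalty_le_limitCost (f : ℝ → ℝ) : penalty f ≤ limitCost (fun x => 1 + |x|) f := by
  refine le_of_forall_gt_imp_ge_of_dense fun C hC => ?_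
  rcases eq_or_ne C ⊤ with rfl | hne
  · exact le_top
  rw [← ENNReal.ofReal_toReal hne]
  refine penalty_le_of_approx fun ε hε => ?_
  have h1 : (⨅ (θ : ReLUNet) (_ : ∀ x, |θ.toFun x - f x| ≤ ε * (1 + |x|)),
      ENNReal.ofReal θ.cost) < C := lt_of_le_of_lt (le_iSup₂_of_le ε hε le_rfl) hC
  simp only [iInf_lt_iff] at h1
  obtain ⟨θ, hθ, hlt⟩ := h1
  exact ⟨θ, hθ, (ENNReal.ofReal_le_iff_le_toReal hne).1 hlt.le⟩

/-! ### Approximation by networks -/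

theorem exists_greenRepr_of_penalty_lt {f : ℝ → ℝ} {C : ℝ≥0∞} (h : penalty f < C) :
    ∃ (a b : ℝ) (P N : Measure ℝ), IsFiniteMeasure P ∧ IsFiniteMeasure N ∧ GreenRepr f a b P N ∧
      ENNReal.ofReal ((P + N).real Set.univ) < C ∧ ENNReal.ofReal (2 * |a|) < C := by
  obtain ⟨h1, h2⟩ := max_lt_iff.1 h
  obtain ⟨P, N, hP, hN, hw, hlt⟩ := exists_weakSecondDeriv_of_secondVariation_lt h1
  obtain ⟨a, b, hr⟩ := hw.exists_greenRepr
  refine ⟨a, b, P, N, hP, hN, hr, ?_, ?_⟩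
  · rwa [measureReal_def, ENNReal.ofReal_toReal (measure_ne_top _ _), Measure.add_apply]
  · rwa [hr.derivLim_add, abs_mul, abs_two] at h2

/-- A function of finite penalty is approximated, exactly on a given finite set and in Lipschitz
seminorm, by networks whose cost does not exceed the penalty. -/
theorem exists_net_lipschitz {f : ℝ → ℝ} {C : ℝ≥0∞} (h : penalty f < C) (S : Finset ℝ) {δ : ℝ}
    (hδ : 0 < δ) :
    ∃ θ : ReLUNet, (∀ x ∈ S, θ.toFun x = f x) ∧
      (∀ x y, |(θ.toFun x - f x) - (θ.toFun y - f y)| ≤ δ * |x - y|) ∧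
      ENNReal.ofReal θ.cost < C := by
  classical
  obtain ⟨a, b, P, N, _, _, hr, hm, ha⟩ := exists_greenRepr_of_penalty_lt h
  obtain ⟨T₀, hT₀⟩ := exists_fine_nodes (P + N) hδ
  obtain ⟨g, c, b', hk, hs, -, heq, hlip⟩ := hr.exists_interpolation
    (T := insert 0 (T₀ ∪ S)) ⟨0, by simp⟩
  obtain ⟨θ, rfl, hcost⟩ := hk.costLE
  refine ⟨θ, fun x hx => heq x (by simp [hx]), hlip δ fun z => ?_, ?_⟩
  · refine (measureReal_mono (nodeCell_anti (fun x hx => ?_) z)).trans (hT₀ z)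
    simp [hx]
  · refine (ENNReal.ofReal_le_ofReal hcost).trans_lt ?_
    rw [ENNReal.ofReal_max]
    exact max_lt ((ENNReal.ofReal_le_ofReal hs).trans_lt hm) ha

theorem limitCost_le_of_forall {w f : ℝ → ℝ} {C : ℝ≥0∞}
    (h : ∀ D > C, ∀ ε > 0, ∃ θ : ReLUNet, (∀ x, |θ.toFun x - f x| ≤ ε * w x) ∧
      ENNReal.ofReal θ.cost ≤ D) : limitCost w f ≤ C := by
  refine le_of_forall_gt_imp_ge_of_dense fun D hD => iSup₂_le fun ε hε => ?_
  obtain ⟨θ, h1, h2⟩ := h D hD ε hε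
  exact iInf₂_le_of_le θ h1 h2

theorem exists_net_weighted {f : ℝ → ℝ} {C : ℝ≥0∞} (h : penalty f < C) (S : Finset ℝ) {δ ε : ℝ}
    (hδ : 0 < δ) (hε : 0 < ε) :
    ∃ θ : ReLUNet, (∀ x ∈ S, θ.toFun x = f x) ∧
      (∀ x y, |(θ.toFun x - f x) - (θ.toFun y - f y)| ≤ δ * |x - y|) ∧
      (∀ x, |θ.toFun x - f x| ≤ ε * (1 + |x|)) ∧ ENNReal.ofReal θ.cost < C := by
  classical
  obtain ⟨θ, h1, h2, h3⟩ := exists_net_lipschitz h (insert 0 S) (lt_min hδ hε)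
  refine ⟨θ, fun x hx => h1 x (by simp [hx]), fun x y => (h2 x y).trans
    (mul_le_mul_of_nonneg_right (min_le_left _ _) (abs_nonneg _)), fun x => ?_, h3⟩
  have h0 : θ.toFun 0 - f 0 = 0 := sub_eq_zero.2 (h1 0 (by simp))
  have hx := h2 x 0
  rw [h0, sub_zero, sub_zero] at hx
  refine hx.trans ?_
  have := mul_le_mul_of_nonneg_right (min_le_right δ ε) (abs_nonneg x)
  linarith

theorem limitCost_weighted_eq_penalty : limitCost (fun x => 1 + |x|) = penalty := by
  funext f
  refine le_antisymm (limitCost_le_of_forall fun D hD ε hε => ?_) (penalty_le_limitCost f)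
  obtain ⟨θ, -, -, h1, h2⟩ := exists_net_weighted hD ∅ one_pos hε
  exact ⟨θ, h1, h2.le⟩

/-! ### Uniform limits -/

section Uniform

variable {f : ℝ → ℝ} {T : Finset ℝ} {c : ℝ → ℝ} {a b : ℝ}

theorem KinkForm.sub_eq_right (h : KinkForm f T c a b) {K x y : ℝ} (hK : ∀ t ∈ T, t ≤ K)
    (hx : K ≤ x) (hy : K ≤ y) : f y - f x = (a + (∑ t ∈ T, c t) / 2) * (y - x) := by
  have e : ∀ z, K ≤ z → ∑ t ∈ T, c t * |z - t| = (∑ t ∈ T, c t) * z - ∑ t ∈ T, c t * t := by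
    intro z hz
    rw [Finset.sum_mul, ← Finset.sum_sub_distrib]
    refine Finset.sum_congr rfl fun t ht => ?_
    rw [abs_of_nonneg (by linarith [hK t ht])]
    ring
  rw [h x, h y, e x hx, e y hy]
  ring

theorem KinkForm.sub_eq_left (h : KinkForm f T c a b) {K x y : ℝ} (hK : ∀ t ∈ T, K ≤ t)
    (hx : x ≤ K) (hy : y ≤ K) : f y - f x = (a - (∑ t ∈ T, c t) / 2) * (y - x) := by
  have e : ∀ z, z ≤ K → ∑ t ∈ T, c t * |z - t| = ∑ t ∈ T, c t * t - (∑ t ∈ T, c t) * z := by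
    intro z hz
    rw [Finset.sum_mul, ← Finset.sum_sub_distrib]
    refine Finset.sum_congr rfl fun t ht => ?_
    rw [abs_of_nonpos (by linarith [hK t ht])]
    ring
  rw [h x, h y, e x hx, e y hy]
  ring

theorem pointMasses_real_sub (T : Finset ℝ) (c : ℝ → ℝ) :
    (pointMasses T c).real Set.univ - (pointMasses T (-c)).real Set.univ = ∑ t ∈ T, c t := by
  simpa using integral_pointMasses_sub T c fun _ => 1

theorem slope_eq_of_bounded {l : Filter ℝ} [l.NeBot] (hl : Tendsto (fun x : ℝ => |x|) l atTop)
    {f g : ℝ → ℝ} {A B ε : ℝ} (hf : Tendsto (fun x => f x / x) l (nhds A))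
    (hg : Tendsto (fun x => g x / x) l (nhds B)) (h : ∀ x, |f x - g x| ≤ ε) : A = B := by
  refine eq_of_abs_sub_nonpos (le_of_forall_gt_imp_ge_of_dense fun η hη => ?_)
  refine abs_slope_sub_le hl hf hg ?_
  filter_upwards [hl.eventually_ge_atTop (ε / η)] with x hx
  rw [div_le_iff₀ hη] at hx
  exact (h x).trans (by nlinarith)

/-- A uniform limit of networks is asymptotic to lines. -/
theorem exists_asymptotic_of_mem_uniformLimits {P N : Measure ℝ} [IsFiniteMeasure P]
    [IsFiniteMeasure N] (hu : f ∈ uniformLimits) (hf : GreenRepr f a b P N) {ε : ℝ} (hε : 0 < ε) :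
    ∃ K : ℝ, (∀ x y, K ≤ x → K ≤ y →
        |f y - f x - (a + (P.real Set.univ - N.real Set.univ) / 2) * (y - x)| ≤ ε) ∧
      ∀ x y, x ≤ -K → y ≤ -K →
        |f y - f x - (a - (P.real Set.univ - N.real Set.univ) / 2) * (y - x)| ≤ ε := by
  obtain ⟨θ, hθ⟩ := hu (ε / 2) (by positivity)
  obtain ⟨T, c, a', b', hk, -, -⟩ := θ.exists_kinkForm
  have hG := hk.greenRepr
  have s1 := slope_eq_of_bounded tendsto_abs_atTop_atTop hG.tendsto_div_atTop
    hf.tendsto_div_atTop hθ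
  have s2 := slope_eq_of_bounded tendsto_abs_atBot_atTop hG.tendsto_div_atBot
    hf.tendsto_div_atBot hθ
  rw [pointMasses_real_sub] at s1 s2
  have hK : ∀ t ∈ T, |t| ≤ ∑ s ∈ T, |s| := fun t ht =>
    Finset.single_le_sum (f := fun s : ℝ => |s|) (fun s _ => abs_nonneg s) ht
  refine ⟨∑ s ∈ T, |s|, fun x y hx hy => ?_, fun x y hx hy => ?_⟩
  · have e := hk.sub_eq_right (fun t ht => (le_abs_self t).trans (hK t ht)) hx hy
    rw [s1] at e
    have h1 := abs_le.1 (hθ x)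
    have h2 := abs_le.1 (hθ y)
    rw [← e, abs_le]
    constructor <;> linarith [h1.1, h1.2, h2.1, h2.2]
  · have e := hk.sub_eq_left (fun t ht => (abs_le.1 (hK t ht)).1) hx hy
    rw [s2] at e
    have h1 := abs_le.1 (hθ x)
    have h2 := abs_le.1 (hθ y)
    rw [← e, abs_le]
    constructor <;> linarith [h1.1, h1.2, h2.1, h2.2]

theorem exists_net_uniform (hu : f ∈ uniformLimits) {C : ℝ≥0∞} (h : penalty f < C) {ε : ℝ}
    (hε : 0 < ε) :
    ∃ θ : ReLUNet, (∀ x, |θ.toFun x - f x| ≤ ε) ∧ ENNReal.ofReal θ.cost < C := by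
  classical
  obtain ⟨a, b, P, N, _, _, hr, hm, ha⟩ := exists_greenRepr_of_penalty_lt h
  obtain ⟨T₀, hT₀⟩ := exists_fine_nodes (P + N) hε
  obtain ⟨K, hKr, hKl⟩ := exists_asymptotic_of_mem_uniformLimits hu hr hε
  obtain ⟨n, hn⟩ := exists_nat_ge (max K (∑ t ∈ T₀, |t|))
  have hnK : K ≤ n := (le_max_left _ _).trans hn
  set T : Finset ℝ := T₀ ∪ (Finset.Icc (-(n : ℤ)) n).image fun i : ℤ => (i : ℝ) with hT
  have hint : ∀ i : ℤ, -(n : ℤ) ≤ i → i ≤ n → (i : ℝ) ∈ T := fun i h1 h2 =>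
    Finset.mem_union_right _ (Finset.mem_image_of_mem _ (Finset.mem_Icc.2 ⟨h1, h2⟩))
  have hTn : ∀ t ∈ T, |t| ≤ n := by
    intro t ht
    rcases Finset.mem_union.1 ht with h1 | h1
    · exact (Finset.single_le_sum (f := fun s : ℝ => |s|) (fun s _ => abs_nonneg s) h1).trans
        ((le_max_right _ _).trans hn)
    · obtain ⟨i, hi, rfl⟩ := Finset.mem_image.1 h1
      obtain ⟨h2, h3⟩ := Finset.mem_Icc.1 hi
      rw [abs_le]
      exact ⟨by exact_mod_cast h2, by exact_mod_cast h3⟩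
  have hn1 : (n : ℝ) ∈ T := by simpa using hint n (by omega) le_rfl
  have hn2 : -(n : ℝ) ∈ T := by simpa using hint (-n) le_rfl (by omega)
  obtain ⟨g, c, b', hk, hs, hsum, heq, hlip⟩ := hr.exists_interpolation (T := T) ⟨n, hn1⟩
  obtain ⟨θ, rfl, hcost⟩ := hk.costLE
  have hlip' := hlip ε fun z => (measureReal_mono
    (nodeCell_anti Finset.subset_union_left z)).trans (hT₀ z)
  refine ⟨θ, fun x => ?_, ?_⟩
  · rcases le_or_gt (n : ℝ) x with h1 | h1
    · have e := hk.sub_eq_right (fun t ht => (le_abs_self t).trans (hTn t ht)) le_rfl h1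
      rw [hsum, heq n hn1] at e
      have := hKr n x hnK (hnK.trans h1)
      rw [← e, abs_sub_comm] at this
      convert this using 2
      ring
    rcases le_or_gt x (-n : ℝ) with h2 | h2
    · have e := hk.sub_eq_left (fun t ht => (abs_le.1 (hTn t ht)).1) le_rfl h2
      rw [hsum, heq _ hn2] at e
      have := hKl (-n) x (by linarith) (by linarith)
      rw [← e, abs_sub_comm] at this
      convert this using 2
      ring
    · have hm : (⌊x⌋ : ℝ) ∈ T := by
        refine hint _ (Int.le_floor.2 ?_) (Int.floor_le_iff.2 ?_)
        · push_cast
          exact h2.le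
        · push_cast
          linarith
      have hx := hlip' x ⌊x⌋
      rw [heq _ hm, sub_self, sub_zero] at hx
      refine hx.trans (mul_le_of_le_one_right hε.le ?_)
      rw [abs_of_nonneg (by linarith [Int.floor_le x])]
      linarith [Int.lt_floor_add_one x]
  · refine (ENNReal.ofReal_le_ofReal hcost).trans_lt ?_
    rw [ENNReal.ofReal_max]
    exact max_lt ((ENNReal.ofReal_le_ofReal hs).trans_lt hm) ha

theorem limitCost_one_eq_penalty (hu : f ∈ uniformLimits) :
    limitCost (fun _ => 1) f = penalty f := by
  refine le_antisymm (limitCost_le_of_forall fun D hD ε hε => ?_) ?_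
  · obtain ⟨θ, h1, h2⟩ := exists_net_uniform hu hD hε
    exact ⟨θ, fun x => by simpa using h1 x, h2.le⟩
  · refine (penalty_le_limitCost f).trans (iSup₂_mono fun ε hε => ?_)
    refine le_iInf₂ fun θ hθ => iInf₂_le θ fun x => (hθ x).trans ?_
    exact mul_le_mul_of_nonneg_left (by linarith [abs_nonneg x]) hε.le

theorem limitCost_one_eq_top (hu : f ∉ uniformLimits) : limitCost (fun _ => 1) f = ⊤ := by
  simp only [uniformLimits, Set.mem_ofPred_eq, not_forall] at hu
  obtain ⟨ε, hε, hn⟩ := hu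
  refine top_le_iff.1 (le_iSup₂_of_le ε hε (le_iInf₂ fun θ hθ => ?_))
  exact absurd ⟨θ, fun x => by simpa using hθ x⟩ hn

end Uniform

/-! ### Objectives -/

section Objectives

variable {L : (ℝ → ℝ) → EReal} {lam : ℝ}

theorem netObjective_eq (L : (ℝ → ℝ) → EReal) (lam : ℝ) (θ : ReLUNet) :
    netObjective L lam θ = L θ.toFun + (lam : EReal) * (ENNReal.ofReal θ.cost : EReal) := by
  rw [netObjective, EReal.coe_ennreal_ofReal, max_eq_left θ.cost_nonneg]

theorem funObjective_le_netObjective (hlam : 0 < lam) (θ : ReLUNet) :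
    funObjective L lam penalty θ.toFun ≤ netObjective L lam θ := by
  rw [netObjective_eq, funObjective]
  refine add_le_add le_rfl (mul_le_mul_of_nonneg_left ?_ (by exact_mod_cast hlam.le))
  exact_mod_cast θ.penalty_le_cost

theorem exists_netObjective_eq (L : (ℝ → ℝ) → EReal) (lam : ℝ) (θ : ReLUNet) :
    ∃ θ' : ReLUNet, θ'.toFun = θ.toFun ∧
      netObjective L lam θ' = funObjective L lam penalty θ.toFun := by
  obtain ⟨θ', h1, h2⟩ := θ.exists_cost_eq_penalty
  exact ⟨θ', h1, by rw [netObjective_eq, h1, h2, funObjective]⟩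

theorem setOf_net_minimizers_eq (hlam : 0 < lam) :
    {f | ∃ θ : ReLUNet, θ.toFun = f ∧ IsMinOn (netObjective L lam) Set.univ θ} =
      {f | f ∈ Set.range ReLUNet.toFun ∧
        IsMinOn (funObjective L lam penalty) (Set.range ReLUNet.toFun) f} := by
  ext f
  simp only [Set.mem_ofPred_eq, isMinOn_iff]
  constructor
  · rintro ⟨θ, rfl, hmin⟩
    refine ⟨⟨θ, rfl⟩, ?_⟩
    rintro _ ⟨η, rfl⟩
    obtain ⟨η', -, h2⟩ := exists_netObjective_eq L lam η
    rw [← h2]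
    exact (funObjective_le_netObjective hlam θ).trans (hmin η' (Set.mem_univ _))
  · rintro ⟨⟨θ, rfl⟩, hmin⟩
    obtain ⟨θ', h1, h2⟩ := exists_netObjective_eq L lam θ
    refine ⟨θ', h1, fun η _ => ?_⟩
    rw [h2]
    exact (hmin _ ⟨η, rfl⟩).trans (funObjective_le_netObjective hlam η)

theorem funObjective_eq_top (hL : ∀ f, L f ≠ ⊥) (hlam : 0 < lam) {R : (ℝ → ℝ) → ℝ≥0∞}
    {f : ℝ → ℝ} (h : R f = ⊤) : funObjective L lam R f = ⊤ := by
  rw [funObjective, h, EReal.coe_ennreal_top, EReal.coe_mul_top_of_pos hlam,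
    EReal.add_top_of_ne_bot (hL f)]

theorem funObjective_limitCost_one {f : ℝ → ℝ} (hu : f ∈ uniformLimits) :
    funObjective L lam (limitCost fun _ => 1) f = funObjective L lam penalty f := by
  rw [funObjective, funObjective, limitCost_one_eq_penalty hu]

theorem funObjective_limitCost_one_eq_top (hL : ∀ f, L f ≠ ⊥) (hlam : 0 < lam) {f : ℝ → ℝ}
    (hu : f ∉ uniformLimits) : funObjective L lam (limitCost fun _ => 1) f = ⊤ :=
  funObjective_eq_top hL hlam (limitCost_one_eq_top hu)

theorem LossUSC.exists_netObjective_lt (hU : LossUSC L) (hL : ∀ f, L f ≠ ⊥) (hlam : 0 < lam)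
    {f : ℝ → ℝ} {c : EReal} (h : funObjective L lam penalty f < c) {ε : ℝ} (hε : 0 < ε) :
    ∃ θ : ReLUNet, (∀ x, |θ.toFun x - f x| ≤ ε * (1 + |x|)) ∧ netObjective L lam θ < c := by
  have hfin : penalty f ≠ ⊤ := fun ht => by
    rw [funObjective_eq_top hL hlam ht] at h
    exact not_top_lt h
  obtain ⟨p, hp⟩ : ∃ p : NNReal, penalty f = p := ⟨_, (ENNReal.coe_toNNReal hfin).symm⟩
  have hg : funObjective L lam penalty f = L f + ((lam * p : ℝ) : EReal) := by
    rw [funObjective, hp, EReal.coe_mul]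
    rfl
  rw [hg] at h
  have hLt : L f ≠ ⊤ := fun ht => by
    rw [ht, EReal.top_add_coe] at h
    exact not_top_lt h
  obtain ⟨l, hl⟩ : ∃ l : ℝ, L f = l := ⟨_, (EReal.coe_toReal hLt (hL f)).symm⟩
  rw [hl, ← EReal.coe_add] at h
  obtain ⟨d, hd1, hd2⟩ := EReal.lt_iff_exists_real_btwn.1 h
  have hd : l + lam * p < d := by exact_mod_cast hd1
  set η := (d - (l + lam * p)) / 2 with hη
  have hη0 : 0 < η := by rw [hη]; linarith
  obtain ⟨S, δ, hδ, hS⟩ := hU f (lt_top_iff_ne_top.2 hfin) ((l + η : ℝ) : EReal)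
    (by rw [hl]; exact_mod_cast (by linarith : l < l + η))
  have hlt : penalty f < ENNReal.ofReal (p + η / lam) := by
    rw [hp, ← ENNReal.ofReal_coe_nnreal]
    exact (ENNReal.ofReal_lt_ofReal_iff (by positivity)).2 (by linarith [div_pos hη0 hlam])
  obtain ⟨θ, h1, h2, h3, h4⟩ := exists_net_weighted hlt S hδ hε
  refine ⟨θ, h3, lt_trans ?_ hd2⟩
  have hc : θ.cost < p + η / lam := (ENNReal.ofReal_lt_ofReal_iff (by positivity)).1 h4
  have hc' : lam * θ.cost < lam * p + η := by
    calc lam * θ.cost < lam * (p + η / lam) := mul_lt_mul_of_pos_left hc hlam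
      _ = _ := by field_simp
  rw [netObjective, ← EReal.coe_mul]
  calc L θ.toFun + ((lam * θ.cost : ℝ) : EReal)
      < ((l + η : ℝ) : EReal) + ((lam * p + η : ℝ) : EReal) :=
        EReal.add_lt_add (hS θ.toFun h1 h2) (by exact_mod_cast hc')
    _ = d := by
      rw [← EReal.coe_add, hη]
      congr 1
      ring

end Objectives

end

theorem corollary3p2 (L : (ℝ → ℝ) → EReal) (hL : ∀ f, L f ≠ ⊥) (lam : ℝ) (hlam : 0 < lam) :
    -- any loss, networks of arbitrary finite width
    ((∀ θ : ReLUNet, IsLeast {v | ∃ θ' : ReLUNet, θ'.toFun = θ.toFun ∧ netObjective L lam θ' = v}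
        (funObjective L lam penalty θ.toFun)) ∧
      {f | ∃ θ : ReLUNet, θ.toFun = f ∧ IsMinOn (netObjective L lam) Set.univ θ} =
        {f | f ∈ Set.range ReLUNet.toFun ∧
          IsMinOn (funObjective L lam penalty) (Set.range ReLUNet.toFun) f}) ∧
    -- any loss, limits of networks of unbounded width, over all functions
    ((⨅ f, funObjective L lam (limitCost (fun x => 1 + |x|)) f) =
        ⨅ f, funObjective L lam penalty f) ∧
    (∀ f, IsMinOn (funObjective L lam (limitCost (fun x => 1 + |x|))) Set.univ f ↔
        IsMinOn (funObjective L lam penalty) Set.univ f) ∧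
    -- any loss, uniform limits of networks of unbounded width
    ((⨅ f, funObjective L lam (limitCost (fun _ => 1)) f) =
        ⨅ f ∈ uniformLimits, funObjective L lam penalty f) ∧
    (∀ f ∈ uniformLimits, IsMinOn (funObjective L lam (limitCost (fun _ => 1))) Set.univ f ↔
        IsMinOn (funObjective L lam penalty) uniformLimits f) ∧
    -- networks of arbitrary finite width against all functions
    (LossUSC L →
      ((⨅ θ, netObjective L lam θ) = ⨅ f, funObjective L lam penalty f) ∧
      {f | ∃ θ : ReLUNet, θ.toFun = f ∧ IsMinOn (netObjective L lam) Set.univ θ} =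
        {f | f ∈ Set.range ReLUNet.toFun ∧
          IsMinOn (funObjective L lam penalty) Set.univ f} ∧
      ∀ f, ∀ c : EReal, funObjective L lam penalty f < c → ∀ ε : ℝ, 0 < ε →
        ∃ θ : ReLUNet, (∀ x, |θ.toFun x - f x| ≤ ε * (1 + |x|)) ∧
          netObjective L lam θ < c) := by
  have hw := limitCost_weighted_eq_penalty
  refine ⟨⟨fun θ => ⟨?_, ?_⟩, setOf_net_minimizers_eq hlam⟩, by rw [hw], fun f => by rw [hw],
    ?_, fun f hf => ?_, fun hU => ⟨?_, ?_, fun f c h ε hε =>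
      hU.exists_netObjective_lt hL hlam h hε⟩⟩
  · exact exists_netObjective_eq L lam θ
  · rintro _ ⟨θ', h, rfl⟩
    rw [← h]
    exact funObjective_le_netObjective hlam θ'
  · refine le_antisymm (le_iInf₂ fun f hf => ?_) (le_iInf fun f => ?_)
    · rw [← funObjective_limitCost_one hf]
      exact iInf_le _ f
    · by_cases hf : f ∈ uniformLimits
      · rw [funObjective_limitCost_one hf]
        exact iInf₂_le f hf
      · rw [funObjective_limitCost_one_eq_top hL hlam hf]
        exact le_top
  · simp only [isMinOn_iff, funObjective_limitCost_one hf, Set.mem_univ, true_implies]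
    refine ⟨fun h g hg => ?_, fun h g => ?_⟩
    · rw [← funObjective_limitCost_one hg]
      exact h g
    · by_cases hg : g ∈ uniformLimits
      · rw [funObjective_limitCost_one hg]
        exact h g hg
      · rw [funObjective_limitCost_one_eq_top hL hlam hg]
        exact le_top
  · refine le_antisymm (le_iInf fun f => le_of_forall_gt_imp_ge_of_dense fun c hc => ?_)
      (le_iInf fun θ => (iInf_le _ θ.toFun).trans (funObjective_le_netObjective hlam θ))
    obtain ⟨θ, -, hθ⟩ := hU.exists_netObjective_lt hL hlam hc one_pos
    exact (iInf_le _ θ).trans hθ.le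
  · rw [setOf_net_minimizers_eq hlam]
    ext f
    simp only [Set.mem_ofPred_eq, isMinOn_iff]
    refine and_congr_right fun _ => ⟨fun h g _ => ?_, fun h g _ => h g (Set.mem_univ g)⟩
    refine le_of_forall_gt_imp_ge_of_dense fun c hc => ?_
    obtain ⟨θ, -, hθ⟩ := hU.exists_netObjective_lt hL hlam hc one_pos
    exact (h _ ⟨θ, rfl⟩).trans ((funObjective_le_netObjective hlam θ).trans hθ.le)
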